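/- Let $k=\mathbb{F}_q$ be a finite field and let $\pi : C\to\mathbb{P}^1$ be a hyperelliptic curve over $k$: $C$ is a smooth projective integral curve over $k$, $\pi$ is a finite morphism, and over the affine line $\pi$ is the projection to $x$ of the affine curve $y^2+h(x)y=f(x)$, where $f,h\in k[x]$, $f$ is monic of degree $2g+1$, $\deg h\le g$ and $g\ge 1$. *Notation.* For $X=C$ or $X=\mathbb{P}^1$ let $|X|$ be the set of closed points, $\deg(x)=[\kappa(x):k]$, and let $Z_0^{\mathrm{eff}}(X)$ be the monoid of effective $0$-cycles $\alpha=\sum_x a_x x$, with $\deg\alpha=\sum_x a_x\deg(x)$. Put $S_1=Z_0^{\mathrm{eff}}(\mathbb{P}^1)$, $T_1=Z_0^{\mathrm{eff}}(C)$, and let $\pi_*:T_1\to S_1$ be the homomorphism with $\pi_*(y)=[\kappa(y):\kappa(\pi(y))]\,\pi(y)$. For $y$ over $x$ let $e(y\mid x)$ be the ramification index and $f(y\mid x)=[\kappa(y):\kappa(x)]$. A point $x\in|\mathbb{P}^1|$ is *ramified* if $e(y\mid x)>1$ for some $y\mapsto x$, *split* if $e(y\mid x)=f(y\mid x)=1$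 for all $y\mapsto x$, and *inert* if it is not ramified and $\pi^{-1}(x)$ is a single closed point. Let $\chi(x)=0,1,-1$ for $x$ ramified, split, inert, respectively. The objective reduced incidence algebra $\widetilde I(\mathbb{P}^1)$ is that of the monoid $S_1$. Its elements are the linear functors $\mathbf{Set}_{/S_1}\to\mathbf{Set}$ represented by spans $S_1\xleftarrow{v}M\to *$ (pull back along $v$, then forget the map to $M$); the sum is the coproduct, and the convolution $F*G$ of $v:M\to S_1$ and $w:N\to S_1$ is represented by the pullback of $v\times w:M\times N\to S_1\times S_1$ along $(d_2,d_0):S_2\to S_1\times S_1$, with leg to $S_1$ given by $d_1$. Here $S_2=S_1\times S_1$ and $\sigma=(\alpha,\beta)\in S_2$ has faces $d_2\sigma=\alpha$, $d_0\sigma=\beta$, $d_1\sigma=\alpha+\beta$. The functors $\zeta_{\mathbb{P}^1}$, $\pi_*\zeta_C$, $L(C)^+$, $L(C)^-$ are represented by $\mathrm{id}:S_1\to S_1$, by $\pi_*:T_1\to S_1$, and by the inclusions into $S_1$ of $$S_1^{+}=\Big\{\alpha : a_x=0\text{ for ramified }x,\ \sum_{x\text{ inert}}a_x\text{ even}\Big\},\qquad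 S_1^{-}=\Big\{\alpha : a_x=0\text{ for ramified }x,\ \sum_{x\text{ inert}}a_x\text{ odd}\Big\}.$$ So $\zeta_{\mathbb{P}^1}*L(C)^{\pm}$ is represented by $d_1:B^{\pm}\to S_1$ with $B^{\pm}=\{\sigma\in S_2 : d_0\sigma\in S_1^{\pm}\}$. For a linear functor $F$ with span $v:M\to S_1$ whose fibres are finite, let $|F|(\alpha)=|v^{-1}(\alpha)|$. **Theorem.** 1. There is an equivalence of linear functors in $\widetilde I(\mathbb{P}^1)$ $$\pi_*\zeta_C+\zeta_{\mathbb{P}^1}*L(C)^-\;\cong\;\zeta_{\mathbb{P}^1}*L(C)^+ .$$ 2. It is realised by a bijection over $S_1$: for every choice of a point $s(x)\in\pi^{-1}(x)$ over each split point $x$, there is a bijection $\varphi:T_1\sqcup B^-\to B^+$ with $d_1\varphi(\beta)=\pi_*\beta$ for $\beta\in T_1$ and $d_1\varphi(\sigma)=d_1\sigma$ for $\sigma\in B^-$, such that for $\beta=\sum_y b_y y\in T_1$ $$d_2\varphi(\beta)=\sum_{\pi(y)\text{ ramified}}b_y\pi_*(y)+\sum_{\substack{\pi(y)\text{ split}\\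 y=s(\pi(y))}}b_y\pi_*(y),\qquad d_0\varphi(\beta)=\sum_{\substack{\pi(y)\text{ split}\\ y\ne s(\pi(y))}}b_y\pi_*(y)+\sum_{\pi(y)\text{ inert}}b_y\pi_*(y).$$ 3. Taking cardinalities recovers the factorization of the zeta function. All fibres of $\pi_*\zeta_C$ and $\zeta_{\mathbb{P}^1}*L(C)^{\pm}$ are finite, $|\pi_*\zeta_C|+|\zeta_{\mathbb{P}^1}*L(C)^-|=|\zeta_{\mathbb{P}^1}*L(C)^+|$ on $S_1$, and there are finitely many $\alpha\in S_1$ of each degree. With $Z(X,t)=\exp\big(\sum_{n\ge1}\#X(\mathbb{F}_{q^n})t^n/n\big)$ and $L(C,t)=\prod_{x\in|\mathbb{P}^1|}(1-\chi(x)t^{\deg x})^{-1}$ (a convergent product in $\mathbb{Q}[[t]]$), $$\sum_{\alpha\in S_1}|\pi_*\zeta_C|(\alpha)t^{\deg\alpha}=Z(C,t),\quad \sum_{\alpha\in S_1}|\zeta_{\mathbb{P}^1}|(\alpha)t^{\deg\alpha}=Z(\mathbb{P}^1,t),\quad \sum_{\alpha\in S_1}\big(|L(C)^+|(\alpha)-|L(C)^-|(\alpha)\big)t^{\deg\alpha}=L(C,t),$$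 and $Z(C,t)=Z(\mathbb{P}^1,t)\,L(C,t)$. -/

import Mathlib

open CategoryTheory AlgebraicGeometry

universe u

noncomputable section

/-! ### Objective linear algebra over `Set` and incidence algebras of monoids -/

/-- A span `A ← M → *` of sets. -/
structure ObjSpan (A : Type u) : Type (u + 1) where
  /-- the apex `M` of the span -/
  apex : Type u
  /-- the leg `M → A` of the span -/
  leg : apex → A

namespace ObjSpan

variable {A A' : Type u}

/-- The linear functor `w_! v^* : Set/A ⥤ Set/* = Set` represented by the span
`A ←v- M -w→ *`: pull back along `v`, then forget the map to `M`. -/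
def linearFunctor (F : ObjSpan A) : Over A ⥤ Type u :=
  Over.pullback (TypeCat.ofHom F.leg) ⋙ Over.forget F.apex

/-- Addition is the coproduct. -/
instance : Add (ObjSpan A) where
  add F G := ⟨F.apex ⊕ G.apex, Sum.elim F.leg G.leg⟩

/-- The linear functor given by a subset of `A` together with its inclusion. -/
def ofSet (s : Set A) : ObjSpan A := ⟨s, Subtype.val⟩

/-- The zeta functor, with span `A ←id- A → *`. -/
def zeta (A : Type u) : ObjSpan A := ⟨A, id⟩

/-- Pushforward along `p : A' → A`: compose the leg of the span with `p`. -/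
def pushforward (p : A' → A) (F : ObjSpan A') : ObjSpan A := ⟨F.apex, p ∘ F.leg⟩

/-- The cardinality of a linear functor, `α ↦ |v⁻¹(α)|`. -/
def card (F : ObjSpan A) (α : A) : ℕ := Nat.card {m : F.apex // F.leg m = α}

section Convolution

variable [Add A]

/-- The set of `2`-simplices of (the bar construction of) the monoid `A`, whose set of
`1`-simplices is `A`: the simplex `(a, b)` has `d₂ = a`, `d₀ = b` and `d₁ = a + b`. -/
abbrev TwoSimplex (A : Type u) : Type u := A × A

/-- A face of a `2`-simplex. -/
def TwoSimplex.d₀ (σ : TwoSimplex A) : A := σ.2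

/-- A face of a `2`-simplex. -/
def TwoSimplex.d₁ (σ : TwoSimplex A) : A := σ.1 + σ.2

/-- A face of a `2`-simplex. -/
def TwoSimplex.d₂ (σ : TwoSimplex A) : A := σ.1

/-- The apex of the span of `F * G`: the pullback of `(d₂, d₀) : S₂ → S₁ × S₁` along the product
of the legs of `F` and `G`. -/
def ConvApex (F G : ObjSpan A) : Type u :=
  {p : TwoSimplex A × (F.apex × G.apex) // (p.1.d₂, p.1.d₀) = (F.leg p.2.1, G.leg p.2.2)}

/-- The projection `ConvApex F G → S₂`. -/
def ConvApex.simplex {F G : ObjSpan A} (p : ConvApex F G) : TwoSimplex A := p.1.1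

/-- Convolution in the objective incidence algebra of the monoid `A`, as a composition of spans. -/
instance : Mul (ObjSpan A) where
  mul F G := ⟨ConvApex F G, fun p => p.simplex.d₁⟩

end Convolution

end ObjSpan

/-! ### Closed points and effective zero-cycles -/

/-- The set `|X|` of closed points of a scheme. -/
def ClosedPt (X : Scheme.{u}) : Type u := {x : X // IsClosed ({x} : Set X)}

/-- The monoid `Z₀ᵉᶠᶠ(X)` of effective zero-cycles. -/
abbrev EffCycle (X : Scheme.{u}) : Type u := ClosedPt X →₀ ℕ

/-- A (universally) closed morphism maps closed points to closed points. -/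
def mapClosedPt {X Y : Scheme.{u}} (π : X ⟶ Y) [UniversallyClosed π] (y : ClosedPt X) :
    ClosedPt Y :=
  ⟨π y.1, by simpa using π.isClosedMap _ y.2⟩

/-- Pushforward of effective zero-cycles, `π_*(y) = [κ(y) : κ(π y)] π(y)`, extended linearly. -/
def pushCycle {X Y : Scheme.{u}} (π : X ⟶ Y) [UniversallyClosed π] : EffCycle X →+ EffCycle Y :=
  Finsupp.liftAddHom fun y =>
    (Finsupp.singleAddHom (mapClosedPt π y)).comp (AddMonoidHom.mulRight (π.residueDegree y.1))

/-- The degree `∑ aₓ deg(x)` of an effective zero-cycle on a scheme `s : X ⟶ Spec k` over a field,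
where `deg(x) = [κ(x) : k]`. -/
def cycleDeg {k : Type u} [Field k] {X : Scheme.{u}} (s : X ⟶ Spec (.of k)) (α : EffCycle X) : ℕ :=
  α.sum fun x a => a * s.residueDegree x.1

/-! ### The projective line and hyperelliptic curves -/

attribute [local instance] MvPolynomial.gradedAlgebra

/-- The projective line `Proj k[X₀, X₁]`. -/
def P1 (k : Type u) [Field k] : Scheme.{u} := Proj (MvPolynomial.homogeneousSubmodule (Fin 2) k)

/-- The structure morphism of the projective line. -/
def P1.toSpec (k : Type u) [Field k] : P1 k ⟶ Spec (.of k) :=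
  Proj.toSpecZero (MvPolynomial.homogeneousSubmodule (Fin 2) k) ≫
    Spec.map (CommRingCat.ofHom (algebraMap k (MvPolynomial.homogeneousSubmodule (Fin 2) k 0)))

/-- The coordinate ring of the standard affine chart `D₊(X₁)`. -/
abbrev P1.ChartRing (k : Type u) [Field k] : Type u :=
  HomogeneousLocalization.Away (MvPolynomial.homogeneousSubmodule (Fin 2) k) (MvPolynomial.X 1)

/-- The inclusion of the standard affine chart `D₊(X₁)`, with coordinate `X₀ / X₁`. -/
def P1.chart (k : Type u) [Field k] : Spec (.of (P1.ChartRing k)) ⟶ P1 k :=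
  Proj.awayι (MvPolynomial.homogeneousSubmodule (Fin 2) k) (MvPolynomial.X 1)
    ((MvPolynomial.mem_homogeneousSubmodule 1 _).2 (MvPolynomial.isHomogeneous_X k 1)) one_pos

/-- The homomorphism from the coordinate ring of the chart `D₊(X₁)` to a `k`-algebra `B` that sends
`X₀ / X₁` to `b`, that is, `F / X₁ⁿ` to `F(b, 1)`. -/
def P1.evalChart {k : Type u} [Field k] {B : Type u} [CommRing B] [Algebra k B] (b : B) :
    P1.ChartRing k →+* B :=
  (IsLocalization.Away.lift (S := Localization.Away (MvPolynomial.X 1 : MvPolynomial (Fin 2) k))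
    (MvPolynomial.X 1) (g := (MvPolynomial.aeval ![b, 1] : MvPolynomial (Fin 2) k →ₐ[k] B).toRingHom)
    (by simp)).comp
  (algebraMap (P1.ChartRing k) (Localization.Away (MvPolynomial.X 1 : MvPolynomial (Fin 2) k)))

open Polynomial in
/-- The affine coordinate ring `k[x, y] / (y² + h(x) y - f(x))`. -/
abbrev HyperellipticRing {k : Type u} [Field k] (f h : k[X]) : Type u :=
  AdjoinRoot (X ^ 2 + Polynomial.C h * X - Polynomial.C f : k[X][X])

open Polynomial in
/-- `π : C ⟶ ℙ¹` is a hyperelliptic curve with its double cover of the projective line: `C` is a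
smooth (over `k`) integral curve, `π` is finite (so that `C` is projective), and over the affine
line `π` is the projection to the `x`-coordinate of the affine curve `y² + h(x) y = f(x)`, with `f`
monic of degree `2g + 1` and `deg h ≤ g`, where `g ≥ 1`. -/
class IsHyperelliptic {k : Type u} [Field k] {C : Scheme.{u}} (π : C ⟶ P1 k) : Prop
    extends IsFinite π where
  integral : IsIntegral C
  smooth : SmoothOfRelativeDimension 1 (π ≫ P1.toSpec k)
  equation : ∃ (g : ℕ) (f h : k[X]) (ι : Spec (.of (HyperellipticRing f h)) ⟶ C),
    1 ≤ g ∧ f.Monic ∧ f.natDegree = 2 * g + 1 ∧ h.natDegree ≤ g ∧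
    IsPullback ι
      (Spec.map (CommRingCat.ofHom
        (P1.evalChart (AdjoinRoot.of (X ^ 2 + Polynomial.C h * X - Polynomial.C f : k[X][X]) X))))
      π (P1.chart k)

/-! ### Splitting types -/

section Splitting

variable {X Y : Scheme.{u}} (π : X ⟶ Y)

/-- The ramification index `e(y | π y)`: the largest `n` with `𝔪_{π y} 𝒪_y ⊆ 𝔪_y ^ n`. -/
def ramIdx (y : X) : ℕ :=
  letI := (π.stalkMap y).hom.toAlgebra
  Ideal.ramificationIdx' (IsLocalRing.maximalIdeal (Y.presheaf.stalk (π y)))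
    (IsLocalRing.maximalIdeal (X.presheaf.stalk y))

variable [UniversallyClosed π]

/-- `x` is ramified: `e(y | x) > 1` for some `y` above `x`. -/
def IsRamifiedPt (x : ClosedPt Y) : Prop :=
  ∃ y : ClosedPt X, mapClosedPt π y = x ∧ 1 < ramIdx π y.1

/-- `x` is split: `e(y | x) = f(y | x) = 1` for all `y` above `x`. -/
def IsSplitPt (x : ClosedPt Y) : Prop :=
  ∀ y : ClosedPt X, mapClosedPt π y = x → ramIdx π y.1 = 1 ∧ π.residueDegree y.1 = 1

/-- `x` is inert: it is not ramified, and there is exactly one closed point above `x`. -/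
def IsInertPt (x : ClosedPt Y) : Prop :=
  ¬ IsRamifiedPt π x ∧ ∃! y : ClosedPt X, mapClosedPt π y = x

open Classical in
/-- The sum of the coefficients of a cycle at the inert points. -/
def inertSum (α : EffCycle Y) : ℕ := ∑ x ∈ α.support with IsInertPt π x, α x

/-- The set `S₁⁺`. -/
def cyclesPlus : Set (EffCycle Y) :=
  {α | (∀ x, IsRamifiedPt π x → α x = 0) ∧ Even (inertSum π α)}

/-- The set `S₁⁻`. -/
def cyclesMinus : Set (EffCycle Y) :=
  {α | (∀ x, IsRamifiedPt π x → α x = 0) ∧ Odd (inertSum π α)}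

/-- The linear functor `L(C)⁺`. -/
def LPlus : ObjSpan (EffCycle Y) := ObjSpan.ofSet (cyclesPlus π)

/-- The linear functor `L(C)⁻`. -/
def LMinus : ObjSpan (EffCycle Y) := ObjSpan.ofSet (cyclesMinus π)

/-- The linear functor `π_* ζ`. -/
def pushZeta : ObjSpan (EffCycle Y) :=
  (ObjSpan.zeta (EffCycle X)).pushforward (pushCycle π)

open Classical in
/-- The quadratic character: `0`, `1`, `-1` at ramified, split and inert points. -/
def quadChar (x : ClosedPt Y) : ℚ :=
  if IsRamifiedPt π x then 0 else if IsSplitPt π x then 1 else if IsInertPt π x then -1 else 0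

end Splitting

/-! ### Zeta functions, `L`-functions and generating functions -/

open Polynomial in
/-- The extension of degree `n` (for `n ≥ 1`) of a finite field `k` with `q` elements: the splitting
field of `X ^ (q ^ n) - X`. -/
abbrev FiniteExt (k : Type u) [Field k] (n : ℕ) : Type u :=
  (X ^ (Nat.card k ^ n) - X : k[X]).SplittingField

/-- The number of `F_{q^n}`-points of `s : X ⟶ Spec F_q`. -/
def pointCount {k : Type u} [Field k] {X : Scheme.{u}} (s : X ⟶ Spec (.of k)) (n : ℕ) : ℕ :=
  Nat.card {p : Spec (.of (FiniteExt k n)) ⟶ X //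
    p ≫ s = Spec.map (CommRingCat.ofHom (algebraMap k (FiniteExt k n)))}

/-- The zeta function `Z(X, t) = exp (∑_{n ≥ 1} #X(F_{q^n}) tⁿ / n)`
(the coefficient for `n = 0` is a division by zero, hence `0`). -/
def zetaSeries {k : Type u} [Field k] {X : Scheme.{u}} (s : X ⟶ Spec (.of k)) : PowerSeries ℚ :=
  (PowerSeries.exp ℚ).subst (PowerSeries.mk fun n => (pointCount s n : ℚ) / n)

/-- The generating function `∑_α a(α) t^{deg α}` of an arithmetic function `a` on effective
zero-cycles. -/
def genSeries {k : Type u} [Field k] {X : Scheme.{u}} (s : X ⟶ Spec (.of k))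
    (a : EffCycle X → ℕ) : PowerSeries ℚ :=
  PowerSeries.mk fun n => ∑ᶠ (α : EffCycle X) (_ : cycleDeg s α = n), (a α : ℚ)

/-- The local factor `(1 - χ(x) t^{deg x})⁻¹` of the `L`-function at a closed point of `Y`. -/
def LFactor {k : Type u} [Field k] {X Y : Scheme.{u}} (π : X ⟶ Y) [UniversallyClosed π]
    (s : Y ⟶ Spec (.of k)) (x : ClosedPt Y) : PowerSeries ℚ :=
  (1 - PowerSeries.C (quadChar π x) * PowerSeries.X ^ s.residueDegree x.1)⁻¹

open scoped PowerSeries.WithPiTopology in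
/-- The Euler product of the local factors converges. -/
def LConverges {k : Type u} [Field k] {X Y : Scheme.{u}} (π : X ⟶ Y) [UniversallyClosed π]
    (s : Y ⟶ Spec (.of k)) : Prop :=
  Multipliable (LFactor π s)

open scoped PowerSeries.WithPiTopology in
/-- The `L`-function `∏ₓ (1 - χ(x) t^{deg x})⁻¹`. -/
def LSeriesOf {k : Type u} [Field k] {X Y : Scheme.{u}} (π : X ⟶ Y) [UniversallyClosed π]
    (s : Y ⟶ Spec (.of k)) : PowerSeries ℚ :=
  ∏' x, LFactor π s x

open Classical in
/-- The part of `π_* β` contributed by the points of `β` that satisfy `P`. -/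
def pushPart {X Y : Scheme.{u}} (π : X ⟶ Y) [UniversallyClosed π] (P : ClosedPt X → Prop)
    (β : EffCycle X) : EffCycle Y :=
  pushCycle π (β.filter P)

end

/-! The heart is local. Over a closed point `x` of the line the fibre satisfies `∑ e f = 2`, so it
is one point with `(e, f) = (2, 1)`, one with `(1, 2)`, or two with `(1, 1)`: ramified, inert or
split. A cycle on `C` therefore amounts to a number at each ramified or inert point and a pair of
numbers at each split point. Put the ramified coefficient in the first component of a pair `(α, β)`,
distribute a split pair over both components, and put the pushforward of an inert coefficient `n`,
which is `2n`, in the second. This map (`splitPush`) identifies cycles on `C` with the pairs such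
that `β` vanishes at ramified points and, at every inert point, `α` is zero and `β` is even.

The remaining pairs cancel by a sign-reversing involution (`toggle`): at an inert point where this
condition fails, one unit moves between `α` and `β`. The sum is kept, the parity of the inert part
of `β` changes, and the set of such bad points is preserved. All odd pairs are bad, so they match
the bad even pairs. In terms of series this is `1/(1 - t²) = 1/(1 - t) · 1/(1 + t)`.

The geometry supplies `∑ e f = 2`. A surjective morphism from an integral scheme has torsion-free,
hence flat, sections over the two charts of the line, whose rings are principal. The rank is 2 on
the chart carrying the equation, and 2 everywhere because the charts share the generic point
(`finrank_eq_two`). Smoothness over a perfect field makes the stalks of `C` principal ideal domains,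
which turns ramification and residue data of stalks into those of primes, where the fundamental
identity holds.

For the series, convolution becomes multiplication (`weightSeries_mul`), completely multiplicative
coefficients give Euler products (`hasProd_eulerFactor`), and counting points over `F_{q^n}` by
closed points of degree dividing `n` identifies the logarithmic derivative
(`weightSeries_one_eq_exp`). The factorization is then the generating function of the cardinality
identity. -/

noncomputable section

/-! ### Generating functions of arithmetic functions on free commutative monoids -/

section WeightSeries

open PowerSeries

variable {P : Type*} (w : P → ℕ)

/-- The generating function `∑_α c(α) t^{w(α)}`, where `w` is extended linearly to finitely
supported multisets `α`. -/
def weightSeries (c : (P →₀ ℕ) → ℚ) : ℚ⟦X⟧ :=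
  PowerSeries.mk fun n => ∑ᶠ (α : P →₀ ℕ) (_ : Finsupp.weight w α = n), c α

variable {w}

/-- All weights being at least 1, a multiset of weight `n` has multiplicities at most `n` and is
supported on the finitely many points of weight at most `n`. -/
theorem finite_weight_eq (hpos : ∀ x, 0 < w x) (hfin : ∀ n, {x | w x ≤ n}.Finite) (n : ℕ) :
    {α : P →₀ ℕ | Finsupp.weight w α = n}.Finite := by
  classical
  refine (((hfin n).toFinset.finsupp fun _ => Finset.range (n + 1)).finite_toSet).subset ?_
  rintro α rfl
  simp only [Finset.mem_coe, Finset.mem_finsupp_iff, Finset.mem_range, Nat.lt_succ_iff]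
  refine ⟨fun x hx => ?_, fun x _ => Finsupp.le_weight w (hpos x).ne' α⟩
  simpa using Finsupp.le_weight_of_ne_zero' w (Finsupp.mem_support_iff.1 hx)

theorem coeff_weightSeries (c : (P →₀ ℕ) → ℚ) {n : ℕ}
    (h : {α : P →₀ ℕ | Finsupp.weight w α = n}.Finite) :
    coeff n (weightSeries w c) = ∑ α ∈ h.toFinset, c α := by
  rw [weightSeries, coeff_mk]
  exact finsum_mem_eq_finite_toFinset_sum _ h

theorem weightSeries_congr {c c' : (P →₀ ℕ) → ℚ} (h : ∀ α, c α = c' α) :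
    weightSeries w c = weightSeries w c' := by
  rw [funext h]

theorem weightSeries_sub (hpos : ∀ x, 0 < w x) (hfin : ∀ n, {x | w x ≤ n}.Finite)
    (c c' : (P →₀ ℕ) → ℚ) :
    weightSeries w (fun α => c α - c' α) = weightSeries w c - weightSeries w c' := by
  ext n
  simp [coeff_weightSeries _ (finite_weight_eq hpos hfin n), Finset.sum_sub_distrib]

/-- The weight is additive, so the splittings `α = β + γ` with `α` of weight `n` regroup according
to the weights of `β` and `γ`. -/
theorem weightSeries_mul [DecidableEq P] (hpos : ∀ x, 0 < w x)
    (hfin : ∀ n, {x | w x ≤ n}.Finite) (c c' : (P →₀ ℕ) → ℚ) :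
    weightSeries w (fun α => ∑ p ∈ Finset.HasAntidiagonal.antidiagonal α, c p.1 * c' p.2) =
      weightSeries w c * weightSeries w c' := by
  ext n
  simp only [coeff_mul, coeff_weightSeries _ (finite_weight_eq hpos hfin _),
    Finset.sum_mul_sum, ← Finset.sum_product']
  rw [Finset.sum_sigma', Finset.sum_sigma']
  refine Finset.sum_bij'
    (fun a _ => ⟨(Finsupp.weight w a.2.1, Finsupp.weight w a.2.2), a.2⟩)
    (fun b _ => ⟨b.2.1 + b.2.2, b.2⟩) ?_ ?_ ?_ ?_ ?_
  · rintro ⟨α, β, γ⟩ h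
    simp only [Finset.mem_sigma, Set.Finite.mem_toFinset, Set.mem_ofPred_eq,
      Finset.HasAntidiagonal.mem_antidiagonal, Finset.mem_product] at h ⊢
    simp [← h.1, ← h.2]
  · rintro ⟨⟨i, j⟩, β, γ⟩ h
    simp only [Finset.mem_sigma, Set.Finite.mem_toFinset, Set.mem_ofPred_eq,
      Finset.HasAntidiagonal.mem_antidiagonal, Finset.mem_product] at h ⊢
    simp [← h.1, h.2]
  · rintro ⟨α, β, γ⟩ h
    simp only [Finset.mem_sigma, Finset.HasAntidiagonal.mem_antidiagonal] at h
    simp [h.2]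
  · rintro ⟨⟨i, j⟩, β, γ⟩ h
    simp only [Finset.mem_sigma, Set.Finite.mem_toFinset, Set.mem_ofPred_eq,
      Finset.mem_product] at h
    simp [h.2]
  · simp

/-- The generating function of a fibrewise count is the generating function of the source. -/
theorem weightSeries_card_fiber {Q : Type*} {v : Q → ℕ} (hpos : ∀ x, 0 < w x)
    (hfin : ∀ n, {x | w x ≤ n}.Finite) (hpos' : ∀ x, 0 < v x) (hfin' : ∀ n, {x | v x ≤ n}.Finite)
    (p : (Q →₀ ℕ) → (P →₀ ℕ)) (hp : ∀ β, Finsupp.weight w (p β) = Finsupp.weight v β) :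
    weightSeries w (fun α => (Nat.card {β // p β = α} : ℚ)) = weightSeries v fun _ => 1 := by
  classical
  ext n
  have hw := finite_weight_eq hpos hfin n
  have hv := finite_weight_eq hpos' hfin' n
  rw [coeff_weightSeries _ hw, coeff_weightSeries _ hv, Finset.sum_const, nsmul_one,
    Finset.card_eq_sum_card_fiberwise (f := p) (t := hw.toFinset)]
  · push_cast
    refine Finset.sum_congr rfl fun α hα => ?_
    rw [Nat.subtype_card]
    intro β
    simp only [Finset.mem_filter, Set.Finite.mem_toFinset, Set.mem_ofPred_eq] at hα ⊢
    exact ⟨fun h => h.2, fun h => ⟨by rw [← hp, h, hα], h⟩⟩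
  · intro β hβ
    simpa [hp] using hβ

/-- The local factor `(1 - c t^d)⁻¹`. -/
def eulerFactor (c : ℚ) (d : ℕ) : ℚ⟦X⟧ := (1 - PowerSeries.C c * PowerSeries.X ^ d)⁻¹

theorem eulerFactor_mul (c : ℚ) {d : ℕ} (hd : 0 < d) :
    eulerFactor c d * (1 - PowerSeries.C c * PowerSeries.X ^ d) = 1 :=
  PowerSeries.inv_mul_cancel _ (by simp [hd.ne'])

/-- The restriction of the multiplicative function with values `χ` to multisets supported
in `s`. -/
def partialEulerCoeff (χ : P → ℚ) (s : Finset P) (α : P →₀ ℕ) : ℚ :=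
  open Classical in if α.support ⊆ s then α.prod fun x a => χ x ^ a else 0

theorem partialEulerCoeff_insert (χ : P → ℚ) [DecidableEq P] {s : Finset P} {x : P}
    (α : P →₀ ℕ) :
    partialEulerCoeff χ (insert x s) (α + Finsupp.single x 1) =
      χ x * partialEulerCoeff χ (insert x s) α := by
  have h : (α + Finsupp.single x 1).support ⊆ insert x s ↔ α.support ⊆ insert x s := by
    simp only [Finset.subset_iff, Finsupp.mem_support_iff, Finset.mem_insert, Finsupp.add_apply,
      Finsupp.single_apply]
    refine forall_congr' fun y => ?_
    by_cases hy : y = x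
    · simp [hy]
    · simp [hy, Ne.symm hy]
  simp only [partialEulerCoeff, h]
  split_ifs
  · rw [Finsupp.prod_add_index' (by simp) (by intros; rw [pow_add])]
    simp [mul_comm]
  · simp

/-- Induction on `s`. Multiplying by `1 - χ(x) t^{w x}` subtracts from each multiset containing `x`
the term obtained by removing one copy of `x`; these cancel, and only multisets without `x` remain.
-/
theorem weightSeries_partialEulerCoeff (hpos : ∀ x, 0 < w x)
    (hfin : ∀ n, {x | w x ≤ n}.Finite) (χ : P → ℚ) (s : Finset P) :
    weightSeries w (partialEulerCoeff χ s) = ∏ x ∈ s, eulerFactor (χ x) (w x) := by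
  classical
  have hD := finite_weight_eq hpos hfin
  induction s using Finset.induction_on with
  | empty =>
    ext n
    rw [coeff_weightSeries _ (hD n), Finset.prod_empty, coeff_one]
    have h : ∀ α : P →₀ ℕ, partialEulerCoeff χ ∅ α = if α = 0 then 1 else 0 := fun α => by
      rw [partialEulerCoeff]
      simp only [Finset.subset_empty, Finsupp.support_eq_empty]
      split_ifs with h
      · simp [h]
      · rfl
    simp only [h, Finset.sum_ite_eq']
    simp [eq_comm]
  | insert x s hx ih =>
    rw [Finset.prod_insert hx, ← ih]
    have key : weightSeries w (partialEulerCoeff χ (insert x s)) *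
        (1 - PowerSeries.C (χ x) * PowerSeries.X ^ w x) =
        weightSeries w (partialEulerCoeff χ s) := by
      ext n
      rw [mul_sub, mul_one, map_sub, mul_left_comm, PowerSeries.coeff_C_mul,
        PowerSeries.coeff_mul_X_pow', sub_eq_iff_eq_add, coeff_weightSeries _ (hD n),
        coeff_weightSeries _ (hD n), ← Finset.sum_filter_add_sum_filter_not _ (fun α => α x = 0)]
      congr 1
      · rw [Finset.sum_filter]
        refine Finset.sum_congr rfl fun α _ => ?_
        have h : α.support ⊆ s ↔ α x = 0 ∧ α.support ⊆ insert x s := by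
          rw [← Finsupp.notMem_support_iff]
          refine ⟨fun h => ⟨fun h' => hx (h h'), h.trans (Finset.subset_insert x s)⟩, ?_⟩
          rintro ⟨h1, h2⟩
          rwa [Finset.subset_insert_iff_of_notMem h1] at h2
        by_cases hα : α x = 0 <;> simp [partialEulerCoeff, h, hα]
      · split_ifs with hn
        · rw [coeff_weightSeries _ (hD _), Finset.mul_sum]
          symm
          refine Finset.sum_bij' (fun α _ => α + Finsupp.single x 1)
            (fun α _ => α - Finsupp.single x 1) ?_ ?_ ?_ ?_ ?_
          · intro α hα
            simp only [Finset.mem_filter, Set.Finite.mem_toFinset, Set.mem_ofPred_eq] at hα ⊢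
            simp [hα, Finsupp.weight_single, hn]
          · intro α hα
            rw [Finset.mem_filter, (hD n).mem_toFinset] at hα
            rw [(hD _).mem_toFinset]
            obtain ⟨rfl, h2⟩ := hα
            have := Finsupp.weight_sub_single_add (w := w) h2
            exact Nat.eq_sub_of_add_eq this
          · intro α _
            simp
          · intro α hα
            simp only [Finset.mem_filter] at hα
            exact tsub_add_cancel_of_le
              (Finsupp.single_le_iff.2 (Nat.one_le_iff_ne_zero.2 hα.2))
          · intro α _
            rw [partialEulerCoeff_insert]
        · rw [mul_zero]
          refine Finset.sum_eq_zero fun α hα => ?_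
          simp only [Finset.mem_filter, Set.Finite.mem_toFinset, Set.mem_ofPred_eq] at hα
          exact absurd (hα.1 ▸ Finsupp.le_weight_of_ne_zero' w hα.2) hn
    rw [← key, mul_comm, mul_assoc, mul_comm (1 - _), eulerFactor_mul _ (hpos x), mul_one]

open scoped PowerSeries.WithPiTopology in
/-- The Euler product of the generating function of a completely multiplicative function. -/
theorem hasProd_eulerFactor (hpos : ∀ x, 0 < w x) (hfin : ∀ n, {x | w x ≤ n}.Finite)
    (χ : P → ℚ) :
    HasProd (fun x => eulerFactor (χ x) (w x))
      (weightSeries w fun α => α.prod fun x a => χ x ^ a) := by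
  rw [HasProd, PowerSeries.WithPiTopology.tendsto_iff_coeff_tendsto]
  intro n
  refine tendsto_const_nhds.congr' ?_
  -- The `n`-th coefficient of the partial product is constant once `s` contains all points of
  -- weight at most `n`.
  filter_upwards [Filter.eventually_ge_atTop (hfin n).toFinset] with s hs
  rw [← weightSeries_partialEulerCoeff hpos hfin, coeff_weightSeries _ (finite_weight_eq hpos hfin n),
    coeff_weightSeries _ (finite_weight_eq hpos hfin n)]
  refine Finset.sum_congr rfl fun α hα => ?_
  rw [partialEulerCoeff, if_pos]
  intro x hx
  apply hs
  simp only [Set.Finite.mem_toFinset, Set.mem_ofPred_eq] at hα ⊢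
  exact hα ▸ Finsupp.le_weight_of_ne_zero' w (Finsupp.mem_support_iff.1 hx)

/-- The operator `t d/dt log` sends `1/(1 - t^d)` to `d t^d/(1 - t^d)`, a series without constant
term; hence the condition `0 < i`. -/
theorem X_mul_derivative_eulerFactor {d : ℕ} (hd : 0 < d) :
    PowerSeries.X * derivative ℚ (eulerFactor 1 d) =
      (PowerSeries.mk fun i => if 0 < i ∧ d ∣ i then (d : ℚ) else 0) * eulerFactor 1 d := by
  set G : ℚ⟦X⟧ := PowerSeries.mk fun i => if 0 < i ∧ d ∣ i then (d : ℚ) else 0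
  have h1 := eulerFactor_mul 1 hd
  rw [map_one, one_mul] at h1
  have hG : G * (1 - PowerSeries.X ^ d) = PowerSeries.C (d : ℚ) * PowerSeries.X ^ d := by
    ext n
    rw [mul_sub, mul_one, map_sub, PowerSeries.coeff_mul_X_pow', PowerSeries.coeff_C_mul,
      PowerSeries.coeff_X_pow]
    simp only [G, PowerSeries.coeff_mk]
    rcases lt_trichotomy n d with h | rfl | h
    · have : ¬ (0 < n ∧ d ∣ n) := fun h' => absurd (Nat.le_of_dvd h'.1 h'.2) (by omega)
      simp [this, h.ne, h.not_ge]
    · simp [hd]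
    · have : (0 < n ∧ d ∣ n) ↔ (0 < n - d ∧ d ∣ n - d) := by
        rw [Nat.dvd_sub_iff_left h.le dvd_rfl]
        simp [h, (hd.trans h)]
      simp only [this, h.le, h.ne', if_true, if_false, mul_zero, sub_self]
  have h2 := congrArg (derivative ℚ) h1
  rw [Derivation.leibniz, map_sub, Derivation.map_one_eq_zero, zero_sub,
    PowerSeries.derivative_pow, PowerSeries.derivative_X, mul_one, smul_eq_mul, smul_eq_mul] at h2
  have hX : PowerSeries.X * (PowerSeries.X ^ (d - 1) : ℚ⟦X⟧) = PowerSeries.X ^ d := by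
    rw [← pow_succ', Nat.sub_add_cancel hd]
  have h0 : (1 - PowerSeries.X ^ d : ℚ⟦X⟧) ≠ 0 := fun h => by simp [h] at h1
  apply mul_right_cancel₀ h0
  have hC : (PowerSeries.C (d : ℚ) : ℚ⟦X⟧) = (d : ℚ⟦X⟧) := by simp
  rw [hC] at hG
  linear_combination PowerSeries.X * h2 - eulerFactor 1 d * hG + (d : ℚ⟦X⟧) * eulerFactor 1 d * hX

theorem X_mul_derivative_prod_eulerFactor (hpos : ∀ x, 0 < w x) (s : Finset P) :
    PowerSeries.X * derivative ℚ (∏ x ∈ s, eulerFactor 1 (w x)) =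
      (∑ x ∈ s, PowerSeries.mk fun i => if 0 < i ∧ w x ∣ i then (w x : ℚ) else 0) *
        ∏ x ∈ s, eulerFactor 1 (w x) := by
  classical
  induction s using Finset.induction_on with
  | empty => simp
  | insert x s hx ih =>
    rw [Finset.prod_insert hx, Finset.sum_insert hx, Derivation.leibniz, smul_eq_mul, smul_eq_mul]
    have := X_mul_derivative_eulerFactor (hpos x)
    linear_combination eulerFactor 1 (w x) * ih + (∏ x ∈ s, eulerFactor 1 (w x)) * this

theorem coeff_weightSeries_one (hpos : ∀ x, 0 < w x) (hfin : ∀ n, {x | w x ≤ n}.Finite)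
    {m n : ℕ} (h : m ≤ n) :
    coeff m (weightSeries w fun _ => 1) =
      coeff m (∏ x ∈ (hfin n).toFinset, eulerFactor 1 (w x)) := by
  rw [← weightSeries_partialEulerCoeff (w := w) hpos hfin (fun _ => 1),
    coeff_weightSeries _ (finite_weight_eq hpos hfin m),
    coeff_weightSeries _ (finite_weight_eq hpos hfin m)]
  refine Finset.sum_congr rfl fun α hα => ?_
  rw [partialEulerCoeff, if_pos]
  · simp
  · intro x hx
    simp only [Set.Finite.mem_toFinset, Set.mem_ofPred_eq] at hα ⊢
    exact (hα ▸ Finsupp.le_weight_of_ne_zero' w (Finsupp.mem_support_iff.1 hx)).trans h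

/-- Up to degree `n` the series agrees with the finite Euler product over points of weight at most
`n`. Its logarithmic derivative is a finite sum, and the points whose weight divides a positive `i ≤
n` are among those kept. -/
theorem X_mul_derivative_weightSeries (hpos : ∀ x, 0 < w x) (hfin : ∀ n, {x | w x ≤ n}.Finite)
    {N : ℕ → ℚ} (hN : ∀ n, 0 < n → N n = ∑ᶠ (x : P) (_ : w x ∣ n), (w x : ℚ)) :
    PowerSeries.X * derivative ℚ (weightSeries w fun _ => 1) =
      (PowerSeries.X * derivative ℚ (PowerSeries.mk fun n => N n / n)) *
        weightSeries w fun _ => 1 := by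
  have hcoeff (f : ℚ⟦X⟧) (n : ℕ) : coeff n (PowerSeries.X * derivative ℚ f) = n * coeff n f := by
    cases n with
    | zero => simp
    | succ n => rw [PowerSeries.coeff_succ_X_mul, PowerSeries.coeff_derivative]; push_cast; ring
  ext n
  rw [hcoeff, coeff_weightSeries_one hpos hfin le_rfl, ← hcoeff,
    X_mul_derivative_prod_eulerFactor hpos, coeff_mul, coeff_mul]
  refine Finset.sum_congr rfl fun p hp => ?_
  have hp' := Finset.HasAntidiagonal.mem_antidiagonal.1 hp
  rw [coeff_weightSeries_one hpos hfin (show p.2 ≤ n by omega), hcoeff, coeff_mk, map_sum]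
  congr 1
  rcases Nat.eq_zero_or_pos p.1 with h0 | h0
  · simp [h0]
  rw [mul_div_cancel₀ _ (by exact_mod_cast h0.ne'), hN _ h0,
    show ∑ᶠ (x : P) (_ : w x ∣ p.1), (w x : ℚ) = ∑ᶠ (x : P) (_ : x ∈ {x | w x ∣ p.1}), (w x : ℚ)
      from rfl,
    finsum_mem_eq_sum_of_subset (s := {x | w x ∣ p.1})
      (t := (hfin n).toFinset.filter (w · ∣ p.1)), Finset.sum_filter]
  · simp [h0]
  · rintro x ⟨hx, -⟩
    have := Nat.le_of_dvd h0 hx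
    simpa using ⟨by omega, hx⟩
  · intro x hx
    simpa using (Finset.mem_filter.1 hx).2

theorem constantCoeff_weightSeries_one (hpos : ∀ x, 0 < w x)
    (hfin : ∀ n, {x | w x ≤ n}.Finite) :
    constantCoeff (weightSeries w fun _ => 1) = 1 := by
  rw [← coeff_zero_eq_constantCoeff_apply, coeff_weightSeries_one hpos hfin le_rfl,
    coeff_zero_eq_constantCoeff_apply, map_prod]
  refine Finset.prod_eq_one fun x _ => ?_
  have := congrArg constantCoeff (eulerFactor_mul 1 (hpos x))
  simpa [(hpos x).ne'] using this

/-- The exponential formula for the generating function of effective cycles. -/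
theorem weightSeries_one_eq_exp (hpos : ∀ x, 0 < w x) (hfin : ∀ n, {x | w x ≤ n}.Finite)
    {N : ℕ → ℚ} (hN : ∀ n, 0 < n → N n = ∑ᶠ (x : P) (_ : w x ∣ n), (w x : ℚ)) :
    weightSeries w (fun _ => 1) = (PowerSeries.exp ℚ).subst (PowerSeries.mk fun n => N n / n) := by
  set L : ℚ⟦X⟧ := PowerSeries.mk fun n => N n / n with hL
  -- The term at 0 is a division by zero, hence 0, which makes the substitution into `exp`
  -- legitimate.
  have hL0 : constantCoeff L = 0 := by
    rw [← PowerSeries.coeff_zero_eq_constantCoeff_apply]; simp [hL]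
  set A := weightSeries w fun _ => 1
  have hA : derivative ℚ A = derivative ℚ L * A := by
    apply mul_left_cancel₀ (PowerSeries.X_ne_zero (R := ℚ))
    rw [X_mul_derivative_weightSeries hpos hfin hN, mul_assoc]
  have hs := HasSubst.of_constantCoeff_zero' hL0
  set G : ℚ⟦X⟧ := (PowerSeries.exp ℚ).subst L with hG
  have hG' : derivative ℚ G = derivative ℚ L * G := by
    rw [hG, PowerSeries.derivative_subst hs, PowerSeries.derivative_exp, mul_comm]
  have hG0 : constantCoeff G = 1 := by
    have h : constantCoeff ((PowerSeries.exp ℚ - 1).subst L) = 0 :=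
      PowerSeries.constantCoeff_subst_eq_zero hL0 _ (by simp)
    rw [← PowerSeries.coe_substAlgHom hs, map_sub, map_one, PowerSeries.coe_substAlgHom hs] at h
    exact sub_eq_zero.1 (by simpa using h)
  -- Both series solve `F' = L' F` with constant term 1, so their quotient has derivative 0.
  have h1 : A * G⁻¹ = 1 := by
    apply PowerSeries.derivative.ext
    · rw [Derivation.leibniz, PowerSeries.derivative_inv', hA, hG', Derivation.map_one_eq_zero,
        smul_eq_mul, smul_eq_mul]
      have := PowerSeries.inv_mul_cancel G (by simp [hG0])
      linear_combination (-(A * derivative ℚ L * G⁻¹)) * this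
    · simp [hG0, A, constantCoeff_weightSeries_one hpos hfin]
  have := PowerSeries.inv_mul_cancel G (by simp [hG0])
  linear_combination G * h1 - A * this

end WeightSeries
end

noncomputable section

/-! ### The combinatorics of double covers -/

section DoubleCover

variable {X Y : Type*}

/-- The fibres of a double cover `m : X → Y` with residue degrees `f`, with `Y` divided
into ramified, split and inert points. -/
structure IsDoubleCover (m : X → Y) (f : X → ℕ) (R S I : Y → Prop) : Prop where
  cases : ∀ y, R y ∨ S y ∨ I y
  not_split_of_ramified : ∀ y, R y → ¬ S y
  not_inert_of_ramified : ∀ y, R y → ¬ I y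
  not_inert_of_split : ∀ y, S y → ¬ I y
  ramified : ∀ y, R y → ∃ x, f x = 1 ∧ ∀ z, m z = y ↔ z = x
  inert : ∀ y, I y → ∃ x, f x = 2 ∧ ∀ z, m z = y ↔ z = x
  split : ∀ y, S y → ∃ x x', x ≠ x' ∧ f x = 1 ∧ f x' = 1 ∧ ∀ z, m z = y ↔ z = x ∨ z = x'

/-- Pushforward of multisets along `m` with multiplicities `f`. -/
def pushMultiset (m : X → Y) (f : X → ℕ) : (X →₀ ℕ) →+ (Y →₀ ℕ) :=
  Finsupp.liftAddHom fun x => (Finsupp.singleAddHom (m x)).comp (AddMonoidHom.mulRight (f x))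

theorem pushMultiset_apply_of_mem_iff {m : X → Y} {f : X → ℕ} {y : Y} {F : Finset X}
    (hF : ∀ x, m x = y ↔ x ∈ F) (β : X →₀ ℕ) :
    pushMultiset m f β y = ∑ x ∈ F, β x * f x := by
  classical
  induction β using Finsupp.induction_linear with
  | zero => simp
  | add β γ hβ hγ => simp [hβ, hγ, add_mul, Finset.sum_add_distrib]
  | single x a =>
    simp only [pushMultiset, Finsupp.liftAddHom_apply_single, AddMonoidHom.comp_apply,
      AddMonoidHom.mulRight_apply, Finsupp.singleAddHom_apply, Finsupp.single_apply, hF,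
      ite_mul, zero_mul, Finset.sum_ite_eq]

/-- This is why `π_*` preserves degrees: the residue degree over the base is multiplicative. -/
theorem weight_pushMultiset (m : X → Y) (f : X → ℕ) (w : Y → ℕ) (β : X →₀ ℕ) :
    Finsupp.weight w (pushMultiset m f β) = Finsupp.weight (fun x => f x * w (m x)) β := by
  induction β using Finsupp.induction_linear with
  | zero => simp
  | add β γ hβ hγ => simp [hβ, hγ]
  | single x a =>
    simp only [pushMultiset, Finsupp.liftAddHom_apply_single, AddMonoidHom.comp_apply,
      AddMonoidHom.mulRight_apply, Finsupp.singleAddHom_apply, Finsupp.weight_single, smul_eq_mul,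
      mul_assoc]

/-! ### The sign-reversing involution at inert points -/

section Toggle

variable (I : Y → Prop)

open Classical in
/-- The sum of the values at the points that satisfy `I`. -/
def sumOver (γ : Y →₀ ℕ) : ℕ := ∑ y ∈ γ.support with I y, γ y

variable {I}

theorem sumOver_add_single {y : Y} (hy : I y) (γ : Y →₀ ℕ) :
    sumOver I (γ + Finsupp.single y 1) = sumOver I γ + 1 := by
  classical
  have h (γ : Y →₀ ℕ) : sumOver I γ = γ.sum fun y a => if I y then a else 0 := by
    rw [sumOver, Finset.sum_filter, Finsupp.sum]
  rw [h, h, Finsupp.sum_add_index' (by simp) (by intros; split_ifs <;> simp)]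
  simp [hy]

theorem even_sumOver {γ : Y →₀ ℕ} (h : ∀ y, I y → Even (γ y)) : Even (sumOver I γ) := by
  classical
  exact Finset.even_sum _ fun y hy => h y (Finset.mem_filter.1 hy).2

variable (I)

/-- The points of `I` at which the pair `σ` is not of the form `(0, even)`. -/
def badSet (σ : (Y →₀ ℕ) × (Y →₀ ℕ)) : Set Y := {y | I y ∧ ¬ (σ.1 y = 0 ∧ Even (σ.2 y))}

open Classical in
/-- Change the parity of the second component at `y`, while keeping the sum. -/
def toggleAt (σ : (Y →₀ ℕ) × (Y →₀ ℕ)) (y : Y) : (Y →₀ ℕ) × (Y →₀ ℕ) :=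
  if Even (σ.2 y) then (σ.1 - Finsupp.single y 1, σ.2 + Finsupp.single y 1)
  else (σ.1 + Finsupp.single y 1, σ.2 - Finsupp.single y 1)

variable {I} {σ : (Y →₀ ℕ) × (Y →₀ ℕ)} {y : Y}

/-- At a bad point the truncated subtraction in `toggleAt` is honest: if the second coefficient is
even, badness forces the first to be positive; if it is odd, it is itself positive. -/
theorem toggleAt_cases (hy : y ∈ badSet I σ) :
    (Even (σ.2 y) ∧ ∃ α, σ.1 = α + Finsupp.single y 1 ∧
      toggleAt σ y = (α, σ.2 + Finsupp.single y 1)) ∨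
    (¬ Even (σ.2 y) ∧ ∃ γ, σ.2 = γ + Finsupp.single y 1 ∧
      toggleAt σ y = (σ.1 + Finsupp.single y 1, γ)) := by
  by_cases h : Even (σ.2 y)
  · refine Or.inl ⟨h, σ.1 - Finsupp.single y 1, ?_, by rw [toggleAt, if_pos h]⟩
    refine (tsub_add_cancel_of_le (Finsupp.single_le_iff.2 (Nat.one_le_iff_ne_zero.2 ?_))).symm
    exact fun h0 => hy.2 ⟨h0, h⟩
  · refine Or.inr ⟨h, σ.2 - Finsupp.single y 1, ?_, by rw [toggleAt, if_neg h]⟩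
    refine (tsub_add_cancel_of_le (Finsupp.single_le_iff.2 (Nat.one_le_iff_ne_zero.2 ?_))).symm
    exact fun h0 => h (by simp [h0])

theorem toggleAt_add (hy : y ∈ badSet I σ) :
    (toggleAt σ y).1 + (toggleAt σ y).2 = σ.1 + σ.2 := by
  obtain ⟨-, α, h1, h2⟩ | ⟨-, γ, h1, h2⟩ := toggleAt_cases hy
  · rw [h2, h1, add_right_comm, add_assoc]
  · rw [h2, h1, add_right_comm, add_assoc]

theorem toggleAt_toggleAt (hy : y ∈ badSet I σ) : toggleAt (toggleAt σ y) y = σ := by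
  obtain ⟨h, α, h1, h2⟩ | ⟨h, γ, h1, h2⟩ := toggleAt_cases hy
  · rw [h2, toggleAt, if_neg]
    · simp [← h1]
    · simpa [Nat.even_add_one] using h
  · rw [h2, toggleAt, if_pos]
    · simp [← h1]
    · simpa [h1, Nat.even_add_one] using h

/-- At `y` badness survives because the second coefficient becomes odd or the first becomes
positive; nothing changes elsewhere. This stability lets a choice depending only on the bad set
define an involution. -/
theorem badSet_toggleAt (hy : y ∈ badSet I σ) : badSet I (toggleAt σ y) = badSet I σ := by
  classical
  ext z
  by_cases hz : z = y
  · subst hz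
    refine ⟨fun _ => hy, fun _ => ⟨hy.1, ?_⟩⟩
    obtain ⟨h, α, h1, h2⟩ | ⟨h, γ, h1, h2⟩ := toggleAt_cases hy
    · rw [h2]
      simp [Nat.even_add_one, h]
    · rw [h2]
      simp
  · obtain ⟨h, α, h1, h2⟩ | ⟨h, γ, h1, h2⟩ := toggleAt_cases hy
    · simp [badSet, h2, h1, Finsupp.single_apply, Ne.symm hz]
    · simp [badSet, h2, h1, Finsupp.single_apply, Ne.symm hz]

theorem even_sumOver_toggleAt (hy : y ∈ badSet I σ) :
    Even (sumOver I (toggleAt σ y).2) ↔ ¬ Even (sumOver I σ.2) := by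
  obtain ⟨h, α, h1, h2⟩ | ⟨h, γ, h1, h2⟩ := toggleAt_cases hy
  · rw [h2, sumOver_add_single hy.1, Nat.even_add_one]
  · rw [h2, h1, sumOver_add_single hy.1, Nat.even_add_one, not_not]

theorem toggleAt_snd_apply_of_not (hy : y ∈ badSet I σ) {z : Y} (hz : ¬ I z) :
    (toggleAt σ y).2 z = σ.2 z := by
  classical
  have hzy : y ≠ z := fun h => hz (h ▸ hy.1)
  obtain ⟨h, α, h1, h2⟩ | ⟨h, γ, h1, h2⟩ := toggleAt_cases hy
  · simp [h2, hzy]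
  · simp [h2, h1, hzy]

variable (I)

open Classical in
/-- Change the parity of the second component at one of the bad points, chosen in terms of the
set of bad points only. -/
def toggle (σ : (Y →₀ ℕ) × (Y →₀ ℕ)) : (Y →₀ ℕ) × (Y →₀ ℕ) :=
  if h : (badSet I σ).Nonempty then toggleAt σ h.some else σ

variable {I}

/-- The chosen point depends on the bad set alone, so `σ` and its image are toggled at the same
point. -/
theorem toggle_eq {s : Set Y} (hs : s.Nonempty) (h : badSet I σ = s) :
    toggle I σ = toggleAt σ hs.some := by
  subst h
  rw [toggle, dif_pos hs]

theorem badSet_toggle : badSet I (toggle I σ) = badSet I σ := by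
  by_cases h : (badSet I σ).Nonempty
  · rw [toggle_eq h rfl, badSet_toggleAt h.some_mem]
  · rw [toggle, dif_neg h]

theorem toggle_toggle : toggle I (toggle I σ) = σ := by
  by_cases h : (badSet I σ).Nonempty
  · rw [toggle_eq h badSet_toggle, toggle_eq h rfl, toggleAt_toggleAt h.some_mem]
  · rw [toggle, dif_neg (by rwa [badSet_toggle]), toggle, dif_neg h]

end Toggle

namespace IsDoubleCover

variable {m : X → Y} {f : X → ℕ} {R S I : Y → Prop} (H : IsDoubleCover m f R S I)
include H

theorem finite_fiber (y : Y) : {x | m x = y}.Finite := by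
  rcases H.cases y with h | h | h
  · obtain ⟨x, -, hx⟩ := H.ramified y h
    simp [hx]
  · obtain ⟨x, x', -, -, -, hx⟩ := H.split y h
    simp only [hx]
    exact Set.toFinite {x, x'}
  · obtain ⟨x, -, hx⟩ := H.inert y h
    simp [hx]

theorem split_sec {sec : Y → X} (hsec : ∀ y, S y → m (sec y) = y) {y : Y} (hy : S y) :
    ∃ x', x' ≠ sec y ∧ f (sec y) = 1 ∧ f x' = 1 ∧ ∀ z, m z = y ↔ z = sec y ∨ z = x' := by
  obtain ⟨x, x', hne, hx, hx', h⟩ := H.split y hy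
  rcases (h (sec y)).1 (hsec y hy) with h' | h'
  · exact ⟨x', by rw [h']; exact hne.symm, by rw [h', hx], hx', by rw [h']; exact h⟩
  · exact ⟨x, by rw [h']; exact hne, by rw [h', hx'], hx, by rw [h']; simpa [or_comm] using h⟩

end IsDoubleCover

open Classical in
/-- The part of the pushforward of `β` contributed by the points that satisfy `Q`. -/
def pushPartOf (m : X → Y) (f : X → ℕ) (Q : X → Prop) (β : X →₀ ℕ) : Y →₀ ℕ :=
  pushMultiset m f (β.filter Q)

/-- The explicit decomposition of the pushforward of a multiset, relative to a choice `sec` of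
points over the split points. -/
def splitPush (m : X → Y) (f : X → ℕ) (R S I : Y → Prop) (sec : Y → X) (β : X →₀ ℕ) :
    (Y →₀ ℕ) × (Y →₀ ℕ) :=
  (pushPartOf m f (fun x => R (m x)) β + pushPartOf m f (fun x => S (m x) ∧ x = sec (m x)) β,
    pushPartOf m f (fun x => S (m x) ∧ x ≠ sec (m x)) β + pushPartOf m f (fun x => I (m x)) β)

/-- The pairs whose second component vanishes on `R` and has a sum over `I` of given parity. -/
def parityPairs (R I : Y → Prop) (p : ℕ → Prop) : Set ((Y →₀ ℕ) × (Y →₀ ℕ)) :=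
  {σ | (∀ y, R y → σ.2 y = 0) ∧ p (sumOver I σ.2)}

namespace IsDoubleCover

variable {m : X → Y} {f : X → ℕ} {R S I : Y → Prop} (H : IsDoubleCover m f R S I)
  {sec : Y → X} (hsec : ∀ y, S y → m (sec y) = y)
include H

theorem splitPush_add (β : X →₀ ℕ) :
    (splitPush m f R S I sec β).1 + (splitPush m f R S I sec β).2 = pushMultiset m f β := by
  classical
  simp only [splitPush, pushPartOf, ← map_add]
  congr 1
  ext x
  simp only [Finsupp.add_apply, Finsupp.filter_apply]
  rcases H.cases (m x) with h | h | h
  · simp [h, H.not_split_of_ramified _ h, H.not_inert_of_ramified _ h]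
  · have : ¬ R (m x) := fun h' => H.not_split_of_ramified _ h' h
    simp only [h, H.not_inert_of_split _ h, this, true_and, if_false, zero_add, add_zero,
      ne_eq, ite_not]
    split_ifs <;> simp
  · have h1 : ¬ R (m x) := fun h' => H.not_inert_of_ramified _ h' h
    have h2 : ¬ S (m x) := fun h' => H.not_inert_of_split _ h' h
    simp [h, h1, h2]

theorem splitPush_of_ramified {x : X} (hx : R (m x)) (β : X →₀ ℕ) :
    (splitPush m f R S I sec β).1 (m x) = β x ∧ (splitPush m f R S I sec β).2 (m x) = 0 := by
  classical
  obtain ⟨x', hf, h⟩ := H.ramified _ hx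
  obtain rfl := (h x).1 rfl
  have h' : ∀ z, m z = m x ↔ z ∈ ({x} : Finset X) := by simpa using h
  simp [splitPush, pushPartOf, pushMultiset_apply_of_mem_iff h', Finsupp.filter_apply, hf, hx,
    H.not_split_of_ramified _ hx, H.not_inert_of_ramified _ hx]

theorem splitPush_of_inert {x : X} (hx : I (m x)) (β : X →₀ ℕ) :
    (splitPush m f R S I sec β).1 (m x) = 0 ∧
      (splitPush m f R S I sec β).2 (m x) = β x * 2 := by
  classical
  obtain ⟨x', hf, h⟩ := H.inert _ hx
  obtain rfl := (h x).1 rfl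
  have h' : ∀ z, m z = m x ↔ z ∈ ({x} : Finset X) := by simpa using h
  have h1 : ¬ R (m x) := fun h' => H.not_inert_of_ramified _ h' hx
  have h2 : ¬ S (m x) := fun h' => H.not_inert_of_split _ h' hx
  simp [splitPush, pushPartOf, pushMultiset_apply_of_mem_iff h', Finsupp.filter_apply, hf, hx,
    h1, h2]

theorem badSet_splitPush (β : X →₀ ℕ) : badSet I (splitPush m f R S I sec β) = ∅ := by
  refine Set.eq_empty_iff_forall_notMem.2 ?_
  rintro y ⟨hy, h⟩
  obtain ⟨x, -, hx⟩ := H.inert y hy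
  obtain rfl := (hx x).2 rfl
  obtain ⟨h1, h2⟩ := H.splitPush_of_inert (sec := sec) hy β
  exact h ⟨h1, by simp [h2]⟩

/-- Residue degree 2 at inert points makes every inert coefficient of the second component even;
ramified points contribute only to the first component. -/
theorem splitPush_mem (β : X →₀ ℕ) : splitPush m f R S I sec β ∈ parityPairs R I Even := by
  refine ⟨fun y hy => ?_, even_sumOver fun y hy => ?_⟩
  · obtain ⟨x, -, hx⟩ := H.ramified y hy
    obtain rfl := (hx x).2 rfl
    exact (H.splitPush_of_ramified hy β).2
  · by_contra h
    exact (H.badSet_splitPush β ▸ (⟨hy, fun h' => h h'.2⟩ :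
      y ∈ badSet I (splitPush m f R S I sec β)) : y ∈ (∅ : Set Y))

/-- The predicates `p`, `p'` are abstract so that one statement serves both directions, odd to even
and even to odd. -/
theorem toggle_mem {p p' : ℕ → Prop} (hp : ∀ n n', (Even n' ↔ ¬ Even n) → p n → p' n')
    {σ : (Y →₀ ℕ) × (Y →₀ ℕ)} (hσ : σ ∈ parityPairs R I p) (h : (badSet I σ).Nonempty) :
    toggle I σ ∈ parityPairs R I p' := by
  rw [toggle_eq h rfl]
  refine ⟨fun y hy => ?_, hp _ _ (even_sumOver_toggleAt h.some_mem) hσ.2⟩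
  rw [toggleAt_snd_apply_of_not h.some_mem (H.not_inert_of_ramified y hy), hσ.1 y hy]

/-- The pairs of odd type correspond to the pairs of even type with bad points. -/
def equivBadPairs :
    parityPairs (Y := Y) R I Odd ≃ {σ : parityPairs (Y := Y) R I Even // ¬ badSet I σ.1 = ∅} where
  toFun σ :=
    -- Without bad points all inert coefficients of the second component would be even, and so would
    -- be their sum.
    have h : (badSet I σ.1).Nonempty := by
      rw [Set.nonempty_iff_ne_empty]
      intro h
      refine Nat.not_even_iff_odd.2 σ.2.2 (even_sumOver fun y hy => ?_)
      by_contra h'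
      exact (h ▸ (⟨hy, fun h'' => h' h''.2⟩ : y ∈ badSet I σ.1) : y ∈ (∅ : Set Y))
    ⟨⟨toggle I σ.1, H.toggle_mem (p := Odd)
        (fun n n' h1 h2 => h1.2 (Nat.not_even_iff_odd.2 h2)) σ.2 h⟩,
      by rw [badSet_toggle]; exact h.ne_empty⟩
  invFun σ := ⟨toggle I σ.1.1, H.toggle_mem (p := Even)
    (fun n n' h1 h2 => Nat.not_even_iff_odd.1 fun h3 => h1.1 h3 h2) σ.1.2
    (Set.nonempty_iff_ne_empty.2 σ.2)⟩
  left_inv σ := Subtype.ext toggle_toggle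
  right_inv σ := Subtype.ext (Subtype.ext toggle_toggle)

include hsec

theorem splitPush_of_split {y : Y} (hy : S y) {x' : X} (hx' : m x' = y) (hne : x' ≠ sec y)
    (β : X →₀ ℕ) :
    (splitPush m f R S I sec β).1 y = β (sec y) ∧ (splitPush m f R S I sec β).2 y = β x' := by
  classical
  obtain ⟨x'', hne', hf, hf', h⟩ := H.split_sec hsec hy
  obtain rfl := ((h x').1 hx').resolve_left hne
  have h' : ∀ z, m z = y ↔ z ∈ ({sec y, x'} : Finset X) := by simpa using h
  have h1 : ¬ R y := fun h' => H.not_split_of_ramified _ h' hy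
  have h2 : ¬ I y := H.not_inert_of_split _ hy
  simp [splitPush, pushPartOf, pushMultiset_apply_of_mem_iff h', Finsupp.filter_apply, hf, hf', hy,
    h1, h2, hx', hsec y hy, hne, Finset.sum_pair hne.symm]

/-- The preimage is read off point by point; halving at an inert point is exact because the point is
not bad. Its support is finite because the fibres of `m` are. -/
theorem exists_splitPush_eq {σ : (Y →₀ ℕ) × (Y →₀ ℕ)} (hR : ∀ y, R y → σ.2 y = 0)
    (hσ : badSet I σ = ∅) : ∃ β, splitPush m f R S I sec β = σ := by
  classical
  have hfin : Set.Finite (m ⁻¹' (σ.1.support ∪ σ.2.support : Finset Y)) :=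
    Set.Finite.preimage' (Finset.finite_toSet _) fun y _ => H.finite_fiber y
  let b : X → ℕ := fun x => if R (m x) then σ.1 (m x) else if S (m x) then
    (if x = sec (m x) then σ.1 (m x) else σ.2 (m x)) else σ.2 (m x) / 2
  have hb : ∀ x, b x ≠ 0 → x ∈ hfin.toFinset := by
    intro x hx
    simp only [Set.Finite.mem_toFinset, Set.mem_preimage, Finset.mem_coe, Finset.mem_union,
      Finsupp.mem_support_iff]
    by_contra! h
    simp [b, h] at hx
  refine ⟨Finsupp.onFinset hfin.toFinset b hb, ?_⟩
  set β := Finsupp.onFinset hfin.toFinset b hb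
  have hβ : ∀ x, β x = b x := fun x => rfl
  suffices h : ∀ y, (splitPush m f R S I sec β).1 y = σ.1 y ∧
      (splitPush m f R S I sec β).2 y = σ.2 y from
    Prod.ext (Finsupp.ext fun y => (h y).1) (Finsupp.ext fun y => (h y).2)
  intro y
  rcases H.cases y with h | h | h
  · obtain ⟨x, -, hx⟩ := H.ramified y h
    obtain rfl := (hx x).2 rfl
    rw [(H.splitPush_of_ramified h β).1, (H.splitPush_of_ramified h β).2, hβ]
    simp [b, h, hR]
  · obtain ⟨x', hne, hf, hf', h'⟩ := H.split_sec hsec h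
    have hx' := (h' x').2 (Or.inr rfl)
    have h1 : ¬ R y := fun h' => H.not_split_of_ramified _ h' h
    obtain ⟨h2, h3⟩ := H.splitPush_of_split hsec h hx' hne β
    rw [h2, h3, hβ, hβ]
    simp [b, h, h1, hsec y h, hx', hne]
  · obtain ⟨x, -, hx⟩ := H.inert y h
    obtain rfl := (hx x).2 rfl
    have h1 : ¬ R (m x) := fun h' => H.not_inert_of_ramified _ h' h
    have h2 : ¬ S (m x) := fun h' => H.not_inert_of_split _ h' h
    obtain ⟨h3, h4⟩ := H.splitPush_of_inert (sec := sec) h β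
    have h5 : σ.1 (m x) = 0 ∧ Even (σ.2 (m x)) := by
      by_contra h5
      exact (hσ ▸ (⟨h, h5⟩ : m x ∈ badSet I σ) : m x ∈ (∅ : Set Y))
    rw [h3, h4, hβ, h5.1]
    simp [b, h1, h2, Nat.div_mul_cancel h5.2.two_dvd]

theorem splitPush_injective : Function.Injective (splitPush m f R S I sec) := by
  intro β β' h
  ext x
  rcases H.cases (m x) with hx | hx | hx
  · rw [← (H.splitPush_of_ramified (sec := sec) hx β).1, h, (H.splitPush_of_ramified hx β').1]
  · obtain ⟨x', hne, hf, hf', h'⟩ := H.split_sec hsec hx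
    have hx' := (h' x').2 (Or.inr rfl)
    obtain ⟨h1, h2⟩ := H.splitPush_of_split hsec hx hx' hne β
    obtain ⟨h3, h4⟩ := H.splitPush_of_split hsec hx hx' hne β'
    rcases (h' x).1 rfl with h5 | h5
    · rw [h5, ← h1, ← h3, h]
    · rw [h5, ← h2, ← h4, h]
  · have := (H.splitPush_of_inert (sec := sec) hx β).2
    rw [h, (H.splitPush_of_inert hx β').2] at this
    omega

/-- The multisets on `X` are the pairs of even type without bad points. -/
def equivGoodPairs :
    (X →₀ ℕ) ≃ {σ : parityPairs (Y := Y) R I Even // badSet I σ.1 = ∅} :=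
  Equiv.ofBijective (fun β => ⟨⟨_, H.splitPush_mem β⟩, H.badSet_splitPush β⟩)
    ⟨fun _ _ h => H.splitPush_injective hsec (congrArg (fun σ => σ.1.1) h), fun σ => by
      obtain ⟨β, hβ⟩ := H.exists_splitPush_eq hsec σ.1.2.1 σ.2
      exact ⟨β, Subtype.ext (Subtype.ext hβ)⟩⟩

open Classical in
/-- The bijection between the multisets on `X` together with the pairs of odd type, and the
pairs of even type. -/
def equivPairs :
    (X →₀ ℕ) ⊕ parityPairs (Y := Y) R I Odd ≃ parityPairs (Y := Y) R I Even :=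
  ((H.equivGoodPairs hsec).sumCongr H.equivBadPairs).trans (Equiv.sumCompl _)

theorem equivPairs_inr (σ : parityPairs (Y := Y) R I Odd) :
    (H.equivPairs hsec (Sum.inr σ)).1.1 + (H.equivPairs hsec (Sum.inr σ)).1.2 =
      σ.1.1 + σ.1.2 := by
  change (toggle I σ.1).1 + (toggle I σ.1).2 = _
  by_cases h : (badSet I σ.1).Nonempty
  · rw [toggle_eq h rfl, toggleAt_add h.some_mem]
  · rw [toggle, dif_neg h]

end IsDoubleCover

end DoubleCover
end

noncomputable section

/-! ### Closed points and rational points over finite fields -/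

section Points

variable {k : Type u} [Field k] {X : Scheme.{u}} (s : X ⟶ Spec (.of k))

theorem residueDegree_comp {X Y Z : Scheme.{u}} (p : X ⟶ Y) (q : Y ⟶ Z) (x : X) :
    (p ≫ q).residueDegree x = p.residueDegree x * q.residueDegree (p x) := by
  let := (q.residueFieldMap (p x)).hom.toAlgebra
  let := (p.residueFieldMap x).hom.toAlgebra
  let a : Algebra (Z.residueField (q (p x))) (X.residueField x) :=
    (q.residueFieldMap (p x) ≫ p.residueFieldMap x).hom.toAlgebra
  have : IsScalarTower (Z.residueField (q (p x))) (Y.residueField (p x)) (X.residueField x) :=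
    IsScalarTower.of_algebraMap_eq fun _ => rfl
  have h := Module.finrank_mul_finrank (Z.residueField (q (p x))) (Y.residueField (p x))
    (X.residueField x)
  rw [mul_comm] at h
  refine Eq.trans ?_ h.symm
  unfold Scheme.Hom.residueDegree
  congr 2
  exact congrArg (fun g : Z.residueField (q (p x)) ⟶ X.residueField x => g.hom.toAlgebra)
    (Scheme.residueFieldMap_comp p q x)

/-- The `k`-algebra structure of the residue fields of a `k`-scheme. -/
def baseToResidue (x : X) : k →+* X.residueField x :=
  (Spec.preimage (X.fromSpecResidueField x ≫ s)).hom

theorem specMap_baseToResidue (x : X) :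
    Spec.map (CommRingCat.ofHom (baseToResidue s x)) = X.fromSpecResidueField x ≫ s :=
  Spec.map_preimage _

theorem isMaximal_of_isPrime_of_field {K : Type*} [Field K] (I : Ideal K) (hI : I.IsPrime) :
    I.IsMaximal := by
  rw [(Ideal.eq_bot_or_top I).resolve_right hI.ne_top]
  exact Ideal.bot_isMaximal

/-- Applied to `Spec k`, this identifies the residue field of its only point with `k`, so that
residue degrees become dimensions over `k`. -/
theorem exists_specMap_eq_fromSpecResidueField {R : CommRingCat.{u}} (z : Spec R)
    (hz : z.asIdeal.IsMaximal) :
    ∃ b : R ⟶ (Spec R).residueField z,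
      Function.Surjective b.hom ∧ Spec.map b = (Spec R).fromSpecResidueField z := by
  refine ⟨CommRingCat.ofHom (algebraMap R z.asIdeal.ResidueField) ≫
    (Scheme.Spec.residueFieldIso _ z).inv, ?_, ?_⟩
  · exact (ConcreteCategory.bijective_of_isIso
      (Scheme.Spec.residueFieldIso _ z).inv).surjective.comp
        (Ideal.algebraMap_residueField_surjective z.asIdeal)
  · rw [Spec.map_comp, Scheme.Spec.map_residueFieldIso_inv_eq_fromSpecResidueField]

theorem residueDegree_eq_finrank (x : X) :
    s.residueDegree x =
      letI := (baseToResidue s x).toAlgebra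
      Module.finrank k (X.residueField x) := by
  obtain ⟨b, hb, hb'⟩ := exists_specMap_eq_fromSpecResidueField (R := .of k) (s x)
    (isMaximal_of_isPrime_of_field (K := k) _ (s x).2)
  have h : CommRingCat.ofHom (baseToResidue s x) = b ≫ s.residueFieldMap x := by
    apply Spec.map_injective
    rw [specMap_baseToResidue, Spec.map_comp, hb',
      Scheme.Hom.SpecMap_residueFieldMap_fromSpecResidueField]
  let b' : k →+* (Spec (.of k)).residueField (s x) := b.hom
  have h' : (s.residueFieldMap x).hom.comp b' = baseToResidue s x :=
    (congrArg CommRingCat.Hom.hom h).symm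
  let := (baseToResidue s x).toAlgebra
  let := (s.residueFieldMap x).hom.toAlgebra
  exact (Algebra.finrank_eq_of_equiv_equiv (RingEquiv.ofBijective b' ⟨b'.injective, hb⟩)
    (RingEquiv.refl (X.residueField x)) h').symm

/-- At a closed point the inclusion of the residue field is a closed immersion, so the field is of
finite type over `k`, and the Nullstellensatz makes it finite. -/
theorem baseToResidue_finite [LocallyOfFiniteType s] (x : ClosedPt X) :
    (baseToResidue s x.1).Finite := by
  have := isClosed_singleton_iff_isClosedImmersion.1 x.2
  have h : LocallyOfFiniteType (X.fromSpecResidueField x.1 ≫ s) := inferInstance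
  rw [← specMap_baseToResidue, HasRingHomProperty.Spec_iff (P := @LocallyOfFiniteType)] at h
  let := (baseToResidue s x.1).toAlgebra
  have : Algebra.FiniteType k (X.residueField x.1) := h
  exact finite_of_finite_type_of_isJacobsonRing k (X.residueField x.1)

theorem residueDegree_pos [LocallyOfFiniteType s] (x : ClosedPt X) :
    0 < s.residueDegree x.1 := by
  rw [residueDegree_eq_finrank]
  let := (baseToResidue s x.1).toAlgebra
  have : Module.Finite k (X.residueField x.1) := baseToResidue_finite s x
  exact Module.finrank_pos

/-- A morphism locally of finite type to a Jacobson scheme sends closed points to closed points. -/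
theorem isClosed_point [LocallyOfFiniteType s] {K : Type u} [Field K] [Algebra k K]
    [FiniteDimensional k K] {p : Spec (.of K) ⟶ X}
    (hp : p ≫ s = Spec.map (CommRingCat.ofHom (algebraMap k K))) (z : Spec (.of K)) :
    IsClosed {p z} := by
  have : JacobsonSpace X := LocallyOfFiniteType.jacobsonSpace s
  have : LocallyOfFiniteType (p ≫ s) := by
    rw [hp, HasRingHomProperty.Spec_iff (P := @LocallyOfFiniteType)]
    exact RingHom.finiteType_algebraMap (A := k) (B := K) |>.2 inferInstance
  have := locallyOfFiniteType_of_comp p s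
  refine p.closePoints_subset_preimage_closedPoints ?_
  exact (PrimeSpectrum.isClosed_singleton_iff_isMaximal (R := K) z).2
    (isMaximal_of_isPrime_of_field (K := K) z.asIdeal z.2)

/-- The `k`-embeddings of the residue field at `x` into an extension `K` of `k`. -/
abbrev ResidueHom (x : X) (K : Type u) [Field K] [Algebra k K] : Type u :=
  {φ : X.residueField x →+* K // φ.comp (baseToResidue s x) = algebraMap k K}

theorem specMap_residueHom_comp {K : Type u} [Field K] [Algebra k K] {x : X}
    (φ : X.residueField x →+* K) :
    (Spec.map (CommRingCat.ofHom φ) ≫ X.fromSpecResidueField x) ≫ s =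
      Spec.map (CommRingCat.ofHom (φ.comp (baseToResidue s x))) := by
  rw [Category.assoc, ← specMap_baseToResidue, ← Spec.map_comp]
  rfl

/-- Points with values in a finite extension `K` correspond to closed points together with
embeddings of their residue fields into `K`. -/
def residueHomEquivPoint [LocallyOfFiniteType s] (K : Type u) [Field K] [Algebra k K]
    [FiniteDimensional k K] :
    (Σ x : ClosedPt X, ResidueHom s x.1 K) ≃
      {p : Spec (.of K) ⟶ X // p ≫ s = Spec.map (CommRingCat.ofHom (algebraMap k K))} :=
  Equiv.ofBijective (fun xφ => ⟨Spec.map (CommRingCat.ofHom xφ.2.1) ≫ X.fromSpecResidueField xφ.1.1,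
    by rw [specMap_residueHom_comp, xφ.2.2]⟩) <| by
    constructor
    · rintro ⟨⟨x, hx⟩, φ, hφ⟩ ⟨⟨x', hx'⟩, φ', hφ'⟩ h
      have h' := (Scheme.SpecToEquivOfField K X).symm.injective
        (a₁ := ⟨x, CommRingCat.ofHom φ⟩) (a₂ := ⟨x', CommRingCat.ofHom φ'⟩)
        (congrArg Subtype.val h)
      obtain ⟨rfl, h2⟩ := Sigma.mk.inj_iff.1 h'
      obtain rfl := congrArg CommRingCat.Hom.hom (eq_of_heq h2)
      rfl
    · rintro ⟨p, hp⟩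
      obtain ⟨⟨x, φ⟩, rfl⟩ := (Scheme.SpecToEquivOfField K X).symm.surjective p
      refine ⟨⟨⟨x, ?_⟩, φ.hom, ?_⟩, rfl⟩
      · have h (z : Spec (.of K)) : (Spec.map φ ≫ X.fromSpecResidueField x) z = x := by
          rw [Scheme.Hom.comp_apply, Scheme.fromSpecResidueField_apply]
        exact h _ ▸ isClosed_point s hp (IsLocalRing.closedPoint K)
      · have h := (specMap_residueHom_comp s φ.hom).symm.trans hp
        exact congrArg CommRingCat.Hom.hom (Spec.map_injective h)

theorem finite_ringHom_comp_eq {A K : Type*} [CommRing A] [Field K] [Algebra k K] [Finite K]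
    {c : k →+* A} (hc : c.FiniteType) :
    Finite {φ : A →+* K // φ.comp c = algebraMap k K} := by
  let := c.toAlgebra
  have : Algebra.FiniteType k A := hc
  obtain ⟨n, g, hg⟩ := Algebra.FiniteType.iff_quotient_mvPolynomial''.1 this
  refine Finite.of_injective (fun φ (i : Fin n) => φ.1 (g (MvPolynomial.X i))) ?_
  rintro ⟨φ, hφ⟩ ⟨φ', hφ'⟩ h
  have : φ.comp g.toRingHom = φ'.comp g.toRingHom := by
    refine MvPolynomial.ringHom_ext (fun a => ?_) fun i => congrFun h i
    have h1 := (DFunLike.congr_fun hφ a).trans (DFunLike.congr_fun hφ' a).symm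
    have h2 : g (MvPolynomial.C a) = c a := g.commutes a
    simpa [h2] using h1
  ext a
  obtain ⟨b, rfl⟩ := hg a
  exact DFunLike.congr_fun this b

/-- Compactness reduces to an affine open, where a point is a homomorphism determined by the images
in the finite field `K` of finitely many generators. -/
theorem finite_points [LocallyOfFiniteType s] [QuasiCompact s]
    (K : Type u) [Field K] [Algebra k K] [Finite K] :
    Finite {p : Spec (.of K) ⟶ X // p ≫ s = Spec.map (CommRingCat.ofHom (algebraMap k K))} := by
  have : CompactSpace X := (quasiCompact_iff_compactSpace s).1 inferInstance
  suffices h : {p : Spec (.of K) ⟶ X | p ≫ s = Spec.map (CommRingCat.ofHom (algebraMap k K)) ∧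
      p (IsLocalRing.closedPoint K) ∈ (Set.univ : Set X)}.Finite by
    exact (h.subset fun p hp => ⟨hp, Set.mem_univ _⟩).to_subtype
  refine isCompact_univ.induction_on (p := fun S : Set X => {p : Spec (.of K) ⟶ X |
    p ≫ s = Spec.map (CommRingCat.ofHom (algebraMap k K)) ∧
      p (IsLocalRing.closedPoint K) ∈ S}.Finite) ?_ ?_ ?_ ?_
  · simp
  · exact fun S T hST hT => hT.subset fun p hp => ⟨hp.1, hST hp.2⟩
  · intro S T hS hT
    refine (hS.union hT).subset ?_
    rintro p ⟨hp, h | h⟩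
    exacts [Or.inl ⟨hp, h⟩, Or.inr ⟨hp, h⟩]
  · intro x _
    obtain ⟨U, hU, hxU, -⟩ := X.isBasis_affineOpens.exists_subset_of_mem_open
      (Set.mem_univ x) isOpen_univ
    obtain ⟨U, hU, rfl⟩ := hU
    refine ⟨U, mem_nhdsWithin_of_mem_nhds (U.2.mem_nhds hxU), ?_⟩
    have hU : IsAffineOpen U := hU
    let c : k →+* Γ(X, U) := (Spec.preimage (hU.fromSpec ≫ s)).hom
    have hc : Spec.map (CommRingCat.ofHom c) = hU.fromSpec ≫ s := Spec.map_preimage _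
    have hc' : c.FiniteType := by
      have h : LocallyOfFiniteType (hU.fromSpec ≫ s) := inferInstance
      rwa [← hc, HasRingHomProperty.Spec_iff (P := @LocallyOfFiniteType)] at h
    have := finite_ringHom_comp_eq (K := K) hc'
    refine (Set.finite_range fun φ : {φ : Γ(X, U) →+* K // φ.comp c = algebraMap k K} =>
      Spec.map (CommRingCat.ofHom φ.1) ≫ hU.fromSpec).subset ?_
    rintro p ⟨hp, hpU⟩
    have hrange : Set.range p ⊆ Set.range hU.fromSpec := by
      rw [hU.range_fromSpec]
      rintro _ ⟨z, rfl⟩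
      rwa [Subsingleton.elim z (IsLocalRing.closedPoint K)]
    obtain ⟨φ, hφ⟩ := Spec.map_surjective (IsOpenImmersion.lift hU.fromSpec p hrange)
    have h1 : Spec.map φ ≫ hU.fromSpec = p := by rw [hφ, IsOpenImmersion.lift_fac]
    refine ⟨⟨φ.hom, ?_⟩, h1⟩
    have h2 : Spec.map (CommRingCat.ofHom c ≫ φ) =
        Spec.map (CommRingCat.ofHom (algebraMap k K)) := by
      rw [Spec.map_comp, hc, ← hp, ← h1, Category.assoc]
    exact congrArg CommRingCat.Hom.hom (Spec.map_injective h2)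

theorem finrank_finiteExt [Finite k] {n : ℕ} (hn : 0 < n) :
    Module.finrank k (FiniteExt k n) = n := by
  obtain ⟨p, hp⟩ := CharP.exists k
  have : Fact p.Prime := ⟨CharP.char_is_prime k p⟩
  let := ZMod.algebra k p
  have : NeZero n := ⟨hn.ne'⟩
  refine Eq.trans ?_ (FiniteField.finrank_extension k p n)
  have e : FiniteField.Extension k p n ≃ₐ[k] FiniteExt k n :=
    Polynomial.IsSplittingField.algEquiv _ _
  exact e.symm.toLinearEquiv.finrank_eq

/-- Galois theory of finite fields: an extension of degree `d` embeds into one of degree `m` only if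
`d ∣ m`, and then in exactly `d` ways. -/
theorem card_residueHom [Finite k] (x : X) (K : Type u) [Field K] [Algebra k K] [Finite K] :
    Nat.card (ResidueHom s x K) =
      if s.residueDegree x ∣ Module.finrank k K then s.residueDegree x else 0 := by
  let := (baseToResidue s x).toAlgebra
  have e : ResidueHom s x K ≃ (X.residueField x →ₐ[k] K) :=
    { toFun φ := { φ.1 with commutes' := fun a => DFunLike.congr_fun φ.2 a }
      invFun φ := ⟨φ.toRingHom, φ.comp_algebraMap⟩
      left_inv φ := rfl
      right_inv φ := rfl }
  rw [Nat.card_congr e, residueDegree_eq_finrank]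
  split_ifs with h
  · exact FiniteField.natCard_algHom_of_finrank_dvd h
  · rw [← FiniteField.nonempty_algHom_iff_finrank_dvd] at h
    have := not_nonempty_iff.1 h
    exact Nat.card_of_isEmpty

instance finite_finiteExt [Finite k] (n : ℕ) : Finite (FiniteExt k n) :=
  Module.finite_of_finite k

/-- Each such closed point carries at least one point with values in the degree `n` extension, and
there are finitely many of those. -/
theorem finite_residueDegree_dvd [Finite k] [LocallyOfFiniteType s] [QuasiCompact s] {n : ℕ}
    (hn : 0 < n) : {x : ClosedPt X | s.residueDegree x.1 ∣ n}.Finite := by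
  have := finite_points s (FiniteExt k n)
  have := Finite.of_equiv _ (residueHomEquivPoint s (FiniteExt k n)).symm
  refine (Set.finite_range fun a : Σ x : ClosedPt X, ResidueHom s x.1 (FiniteExt k n) =>
    a.1).subset fun x hx => ?_
  have h := card_residueHom s x.1 (FiniteExt k n)
  rw [finrank_finiteExt hn, if_pos (show s.residueDegree x.1 ∣ n from hx)] at h
  have := (Nat.card_pos_iff.1 (h ▸ residueDegree_pos s x)).1
  exact ⟨⟨x, this.some⟩, rfl⟩

theorem finite_residueDegree_le [Finite k] [LocallyOfFiniteType s] [QuasiCompact s] (n : ℕ) :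
    {x : ClosedPt X | s.residueDegree x.1 ≤ n}.Finite := by
  -- Every positive integer up to `n` divides `n!`, so a single extension bounds all these points.
  refine (finite_residueDegree_dvd s (Nat.factorial_pos n)).subset fun x hx => ?_
  exact Nat.dvd_factorial (residueDegree_pos s x) hx

/-- Sort the points over `F_{q^n}` by their image: a closed point of degree `d` receives `d` of them
if `d ∣ n` and none otherwise. -/
theorem pointCount_eq [Finite k] [LocallyOfFiniteType s] [QuasiCompact s] {n : ℕ} (hn : 0 < n) :
    (pointCount s n : ℚ) =
      ∑ᶠ (x : ClosedPt X) (_ : s.residueDegree x.1 ∣ n), (s.residueDegree x.1 : ℚ) := by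
  classical
  have := finite_points s (FiniteExt k n)
  have := Finite.of_equiv _ (residueHomEquivPoint s (FiniteExt k n)).symm
  have hfin := finite_residueDegree_dvd s hn
  rw [show (∑ᶠ (x : ClosedPt X) (_ : s.residueDegree x.1 ∣ n), (s.residueDegree x.1 : ℚ)) =
    ∑ᶠ (x : ClosedPt X) (_ : x ∈ {x : ClosedPt X | s.residueDegree x.1 ∣ n}),
      (s.residueDegree x.1 : ℚ) from rfl, finsum_mem_eq_finite_toFinset_sum _ hfin, pointCount,
    ← Nat.card_congr (residueHomEquivPoint s (FiniteExt k n))]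
  have := Fintype.ofFinite (Σ x : ClosedPt X, ResidueHom s x.1 (FiniteExt k n))
  rw [Nat.card_eq_fintype_card, ← Finset.card_univ,
    Finset.card_eq_sum_card_fiberwise (f := Sigma.fst) (t := hfin.toFinset)]
  · push_cast
    refine Finset.sum_congr rfl fun x hx => ?_
    have h := card_residueHom s x.1 (FiniteExt k n)
    rw [finrank_finiteExt hn, if_pos (show s.residueDegree x.1 ∣ n from hfin.mem_toFinset.1 hx)] at h
    have h' := Nat.card_congr
      (Equiv.sigmaSubtype (β := fun x : ClosedPt X => ResidueHom s x.1 (FiniteExt k n)) x)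
    rw [← h, ← h', Nat.subtype_card (Finset.univ.filter fun a => a.1 = x) (by simp)]
  · intro a _
    have h := card_residueHom s a.1.1 (FiniteExt k n)
    rw [finrank_finiteExt hn] at h
    have : Nonempty (ResidueHom s a.1.1 (FiniteExt k n)) := ⟨a.2⟩
    have : Finite (ResidueHom s a.1.1 (FiniteExt k n)) :=
      Finite.of_injective (fun φ => (⟨a.1, φ⟩ : Σ x : ClosedPt X, ResidueHom s x.1 (FiniteExt k n)))
        fun _ _ h => eq_of_heq (Sigma.mk.inj_iff.1 h).2
    refine hfin.mem_toFinset.2 (not_not.1 fun h' => ?_)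
    rw [if_neg (show ¬ s.residueDegree a.1.1 ∣ n from h')] at h
    exact Nat.card_pos.ne' h

theorem genSeries_one_eq_zetaSeries [Finite k] [LocallyOfFiniteType s] [QuasiCompact s] :
    (weightSeries (fun x : ClosedPt X => s.residueDegree x.1) fun _ => 1) = zetaSeries s :=
  weightSeries_one_eq_exp (fun x => residueDegree_pos s x) (finite_residueDegree_le s)
    fun _ hn => pointCount_eq s hn

end Points
end

noncomputable section

/-! ### Local rings of smooth curves -/

section SmoothCurve

open IsLocalRing TensorProduct

/-- The cotangent space embeds in a space of dimension at most 1. The ideal `I` is kept separate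
from `maximalIdeal O` so that the kernel of the residue map can be used directly. -/
theorem isPrincipal_maximalIdeal_of_injective {O : Type*} [CommRing O] [IsLocalRing O]
    [IsNoetherianRing O] {I : Ideal O} (hI : I = maximalIdeal O) {M : Type*} [AddCommGroup M]
    [Module O M] [Module (ResidueField O) M] [IsScalarTower O (ResidueField O) M]
    [Module.Finite (ResidueField O) M] (hM : Module.finrank (ResidueField O) M ≤ 1)
    {l : I.Cotangent →ₗ[O] M} (hl : Function.Injective l) : (maximalIdeal O).IsPrincipal := by
  subst hI
  rw [← finrank_cotangentSpace_le_one_iff]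
  let l' : CotangentSpace O →ₗ[ResidueField O] M :=
    LinearMap.extendScalarsOfSurjective Ideal.Quotient.mk_surjective l
  exact (LinearMap.finrank_le_finrank_of_injective (f := l') hl).trans hM

/-- The local rings of a smooth curve over a perfect field are principal ideal domains. -/
theorem isPrincipalIdealRing_of_isStandardSmooth (k A O : Type*) [Field k] [PerfectField k]
    [CommRing A] [CommRing O] [Algebra k A] [Algebra A O] [Algebra k O] [IsScalarTower k A O]
    [Algebra.IsStandardSmoothOfRelativeDimension 1 k A] (p : Ideal A) [p.IsPrime]
    [IsLocalization.AtPrime O p] [IsLocalRing O] [IsDomain O] : IsPrincipalIdealRing O := by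
  have : Algebra.IsStandardSmooth k A :=
    Algebra.IsStandardSmoothOfRelativeDimension.isStandardSmooth 1
  have : IsNoetherianRing A := Algebra.FiniteType.isNoetherianRing k A
  have : IsNoetherianRing O := IsLocalization.isNoetherianRing p.primeCompl O inferInstance
  have : Algebra.FormallyEtale A O := Algebra.FormallyEtale.of_isLocalization p.primeCompl
  have : Algebra.FormallySmooth k O := Algebra.FormallySmooth.comp k A O
  have : Algebra.EssFiniteType A O := Algebra.EssFiniteType.of_isLocalization O p.primeCompl
  have : Algebra.EssFiniteType k O := Algebra.EssFiniteType.comp k A O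
  have : Algebra.EssFiniteType k (ResidueField O) := Algebra.EssFiniteType.comp k O _
  have : Algebra.FormallySmooth k (ResidueField O) := inferInstance
  -- As `k` is perfect, the residue field is formally smooth over it, so the conormal map from
  -- `𝔪/𝔪²` to `κ ⊗ Ω` is split injective. The target has dimension 1.
  obtain ⟨l, hl⟩ := (Algebra.FormallySmooth.iff_split_injection (R := k) (P := O)
    (A := ResidueField O) Ideal.Quotient.mk_surjective).1 this
  have : Nontrivial A := (algebraMap A O).domain_nontrivial
  have hfree : Module.Free A Ω[A⁄k] := inferInstance
  have hfin : Module.Finite A Ω[A⁄k] := inferInstance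
  have hrank : Module.finrank A Ω[A⁄k] = 1 := by
    rw [Module.finrank, Algebra.IsStandardSmoothOfRelativeDimension.rank_kaehlerDifferential 1]
    simp
  let e := KaehlerDifferential.tensorKaehlerEquivOfFormallyEtale k A O
  have : Module.Finite O Ω[O⁄k] := Module.Finite.equiv e
  have : Module.Free O Ω[O⁄k] := Module.Free.of_equiv e
  have hrank' : Module.finrank O Ω[O⁄k] = 1 := by
    rw [← e.finrank_eq, Module.finrank_baseChange, hrank]
  have h : (maximalIdeal O).IsPrincipal := by
    refine isPrincipal_maximalIdeal_of_injective (M := ResidueField O ⊗[O] Ω[O⁄k])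
      (I := RingHom.ker (algebraMap O (ResidueField O))) (ker_residue (R := O)) ?_
      (l := KaehlerDifferential.kerCotangentToTensor k O (ResidueField O)) ?_
    · rw [Module.finrank_baseChange, hrank']
    · exact (Function.LeftInverse.injective (g := l) fun x => LinearMap.congr_fun hl x)
  exact ((tfae_of_isNoetherianRing_of_isLocalRing_of_isDomain O).out 4 0).1 h

theorem isPrincipalIdealRing_stalk {k : Type u} [Field k] [Finite k] {X : Scheme.{u}}
    [IsIntegral X] (s : X ⟶ Spec (.of k)) [SmoothOfRelativeDimension 1 s] (x : X) :
    IsPrincipalIdealRing (X.presheaf.stalk x) := by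
  obtain ⟨U, hU, V, hV, hx, e, h⟩ :=
    SmoothOfRelativeDimension.exists_isStandardSmoothOfRelativeDimension (n := 1) (f := s) x
  have hUtop : U = ⊤ := by
    ext z
    simpa [Subsingleton.elim z (s x)] using! e hx
  subst hUtop
  -- The smooth chart lives over the global sections of `Spec k`; transporting the field structure
  -- and finiteness of `k` there makes them a perfect field.
  let i : Γ(Spec (.of k), ⊤) ≃+* k := (Scheme.ΓSpecIso (.of k)).commRingCatIsoToRingEquiv
  let : Field Γ(Spec (.of k), ⊤) := (i.toMulEquiv.isField (Field.toIsField k)).toField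
  have : Finite Γ(Spec (.of k), ⊤) := Finite.of_equiv _ i.symm.toEquiv
  let := (s.appLE ⊤ V e).hom.toAlgebra
  let := TopCat.Presheaf.algebra_section_stalk X.presheaf ⟨x, hx⟩
  let : Algebra Γ(Spec (.of k), ⊤) (X.presheaf.stalk x) :=
    ((algebraMap Γ(X, V) (X.presheaf.stalk x)).comp (algebraMap _ _)).toAlgebra
  have : IsScalarTower Γ(Spec (.of k), ⊤) Γ(X, V) (X.presheaf.stalk x) :=
    IsScalarTower.of_algebraMap_eq fun _ => rfl
  have : Algebra.IsStandardSmoothOfRelativeDimension 1 Γ(Spec (.of k), ⊤) Γ(X, V) := h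
  have := hV.isLocalization_stalk ⟨x, hx⟩
  exact isPrincipalIdealRing_of_isStandardSmooth Γ(Spec (.of k), ⊤) Γ(X, V) (X.presheaf.stalk x)
    (hV.primeIdealOf ⟨x, hx⟩).asIdeal

end SmoothCurve
end

noncomputable section

/-! ### Ramification and inertia under localization -/

section Localization

variable {R S A B : Type*} [CommRing R] [CommRing S] [CommRing A] [CommRing B]
  [IsLocalRing A] [IsLocalRing B] [Algebra R S] [Algebra R A] [Algebra S B] [Algebra A B]
  [Algebra R B] [IsScalarTower R S B] [IsScalarTower R A B]
  (p : Ideal R) [p.IsMaximal] (q : Ideal S) [q.IsMaximal]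
  [IsLocalization.AtPrime A p] [IsLocalization.AtPrime B q]

open IsLocalRing

theorem ramificationIdx_maximalIdeal_of_isLocalization (q : Ideal S) [q.IsPrime]
    [IsLocalization.AtPrime B q] : (maximalIdeal B).ramificationIdx S = 1 := by
  have : Algebra.FormallyUnramified S B := .of_isLocalization q.primeCompl
  have : Algebra.EssFiniteType S B := .of_isLocalization _ q.primeCompl
  have : Algebra.IsUnramifiedAt S (maximalIdeal B) := by
    have : Algebra.FormallyUnramified B (Localization.AtPrime (maximalIdeal B)) :=
      .of_isLocalization (maximalIdeal B).primeCompl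
    exact Algebra.FormallyUnramified.comp S B _
  exact Ideal.ramificationIdx_eq_one _ _

theorem inertiaDeg_maximalIdeal_of_isLocalization (q : Ideal S) [q.IsMaximal]
    [IsLocalization.AtPrime B q] : (maximalIdeal B).inertiaDeg S = 1 := by
  have : (maximalIdeal B).LiesOver q :=
    ⟨(IsLocalization.AtPrime.under_maximalIdeal B q).symm⟩
  rw [Ideal.inertiaDeg_eq_of_isMaximal q]
  let := Ideal.Quotient.field q
  let e := IsLocalization.AtPrime.equivQuotMaximalIdeal q B
  have h := Algebra.finrank_eq_of_equiv_equiv (R₀ := S ⧸ q) (S₀ := S ⧸ q) (R₁ := S ⧸ q)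
    (S₁ := B ⧸ maximalIdeal B) (RingEquiv.refl _) e (by
      ext x
      simp [e])
  rw [← h, Module.finrank_self]

-- Compare the towers `R → S → B` and `R → A → B`: the index is multiplicative, and the localization
-- steps contribute 1 because localizations are unramified.
include p in
theorem ramificationIdx_eq_maximalIdeal [q.LiesOver p] [Module.Flat A B] [IsDomain B]
    [IsPrincipalIdealRing B] [IsLocalHom (algebraMap A B)]
    (h : (maximalIdeal A).map (algebraMap A B) ≠ ⊥) :
    q.ramificationIdx R = (maximalIdeal A).ramificationIdx' (maximalIdeal B) := by
  have : (maximalIdeal B).LiesOver q :=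
    ⟨(IsLocalization.AtPrime.under_maximalIdeal B q).symm⟩
  have : Module.Flat S B := IsLocalization.flat B q.primeCompl
  rw [Ideal.ramificationIdx'_eq_ramificationIdx' _ _ h]
  have h₁ := Ideal.ramificationIdx_tower (R := R) q (maximalIdeal B)
  have h₂ := Ideal.ramificationIdx_tower (R := R) (maximalIdeal A) (maximalIdeal B)
  rw [ramificationIdx_maximalIdeal_of_isLocalization q] at h₁
  rw [ramificationIdx_maximalIdeal_of_isLocalization (B := A) p] at h₂
  omega

include p in
theorem inertiaDeg_eq_residueField [q.LiesOver p] [IsLocalHom (algebraMap A B)] :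
    q.inertiaDeg R = Module.finrank (ResidueField A) (ResidueField B) := by
  have : (maximalIdeal B).LiesOver q :=
    ⟨(IsLocalization.AtPrime.under_maximalIdeal B q).symm⟩
  have h₁ := Ideal.inertiaDeg_tower (R := R) q (maximalIdeal B)
  have h₂ := Ideal.inertiaDeg_tower (R := R) (maximalIdeal A) (maximalIdeal B)
  rw [inertiaDeg_maximalIdeal_of_isLocalization q] at h₁
  rw [inertiaDeg_maximalIdeal_of_isLocalization (B := A) p] at h₂
  have h₃ : (maximalIdeal B).inertiaDeg A = Module.finrank (ResidueField A) (ResidueField B) :=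
    Ideal.inertiaDeg_eq_of_isMaximal (maximalIdeal A) (maximalIdeal B)
  omega

end Localization

/-! ### Fibres of finite flat morphisms -/

section Fibre

open IsLocalRing

variable {X Y : Scheme.{u}} (π : X ⟶ Y) [IsFinite π] {U : Y.Opens} (hU : IsAffineOpen U)

include hU in
theorem primesOver_preimage_bijective (x : ClosedPt Y) (hx : x.1 ∈ U) :
    letI := (π.app U).hom.toAlgebra
    ∃ E : {y : ClosedPt X // mapClosedPt π y = x} ≃
        (hU.primeIdealOf ⟨x.1, hx⟩).asIdeal.primesOver Γ(X, π ⁻¹ᵁ U),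
      ∀ y (hy : y.1.1 ∈ π ⁻¹ᵁ U),
        (E y).1 = ((hU.preimage π).primeIdealOf ⟨y.1.1, hy⟩).asIdeal := by
  have hV := hU.preimage π
  let := (π.app U).hom.toAlgebra
  have hmem (y : ClosedPt X) (h : mapClosedPt π y = x) : y.1 ∈ π ⁻¹ᵁ U := by
    have : π y.1 = x.1 := congrArg Subtype.val h
    show π y.1 ∈ U
    rwa [this]
  have hcomap (y : X) (hy : y ∈ π ⁻¹ᵁ U) :
      (hV.primeIdealOf ⟨y, hy⟩).comap (π.app U).hom = hU.primeIdealOf ⟨π y, hy⟩ := by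
    rw [Scheme.Hom.app_eq_appLE]
    exact IsAffineOpen.comap_primeIdealOf_appLE U hU _ hV le_rfl hy
  have hpm : (hU.primeIdealOf ⟨x.1, hx⟩).asIdeal.IsMaximal :=
    hU.primeIdealOf_isMaximal_of_isClosed _ x.2
  have hlies (y : ClosedPt X) (h : mapClosedPt π y = x) :
      (hV.primeIdealOf ⟨y.1, hmem y h⟩).asIdeal.LiesOver (hU.primeIdealOf ⟨x.1, hx⟩).asIdeal := by
    constructor
    have h' : (⟨x.1, hx⟩ : U) = ⟨π y.1, hmem y h⟩ := Subtype.ext (congrArg Subtype.val h).symm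
    rw [h', ← hcomap]
    rfl
  let E₀ : {y : ClosedPt X // mapClosedPt π y = x} →
        (hU.primeIdealOf ⟨x.1, hx⟩).asIdeal.primesOver Γ(X, π ⁻¹ᵁ U) :=
    fun y => ⟨(hV.primeIdealOf ⟨y.1.1, hmem y.1 y.2⟩).asIdeal, inferInstance, hlies y.1 y.2⟩
  refine ⟨Equiv.ofBijective E₀ ⟨fun y z h => ?_, fun q => ?_⟩, fun y hy => rfl⟩
  · have h' : hV.primeIdealOf ⟨y.1.1, hmem y.1 y.2⟩ = hV.primeIdealOf ⟨z.1.1, hmem z.1 z.2⟩ :=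
      PrimeSpectrum.ext (congrArg Subtype.val h)
    have := congrArg hV.fromSpec h'
    rw [hV.fromSpec_primeIdealOf, hV.fromSpec_primeIdealOf] at this
    exact Subtype.ext (Subtype.ext this)
  · have hq : q.1.IsPrime := q.2.1
    have hq' : q.1.LiesOver _ := q.2.2
    have : Algebra.IsIntegral Γ(Y, U) Γ(X, π ⁻¹ᵁ U) :=
      ⟨(IsFinite.finite_app π U hU).to_isIntegral⟩
    have hqm : q.1.IsMaximal := Ideal.IsMaximal.of_liesOver_isMaximal q.1
      (hU.primeIdealOf ⟨x.1, hx⟩).asIdeal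
    let q₀ : PrimeSpectrum Γ(X, π ⁻¹ᵁ U) := ⟨q.1, hq⟩
    let y : X := hV.fromSpec q₀
    have hyV : y ∈ π ⁻¹ᵁ U := by
      have : y ∈ Set.range hV.fromSpec := ⟨_, rfl⟩
      rwa [hV.range_fromSpec] at this
    have hy : hV.primeIdealOf ⟨y, hyV⟩ = q₀ := hV.fromSpec.isOpenEmbedding.injective
      (hV.fromSpec_primeIdealOf ⟨y, hyV⟩)
    have hπy : π y = x.1 := by
      have h₁ := hcomap y hyV
      have h₂ : q₀.comap (π.app U).hom = hU.primeIdealOf ⟨x.1, hx⟩ :=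
        PrimeSpectrum.ext hq'.over.symm
      rw [hy, h₂] at h₁
      have := congrArg hU.fromSpec h₁
      rw [hU.fromSpec_primeIdealOf, hU.fromSpec_primeIdealOf] at this
      exact this.symm
    -- A specialization of `y` in all of `X` still maps to the closed point `x`, hence lies in the
    -- affine preimage, where maximality of `q` forces equality.
    have hclosed : IsClosed ({y} : Set X) := by
      rw [← closure_subset_iff_isClosed]
      intro z hz
      have hyz : y ⤳ z := specializes_iff_mem_closure.2 hz
      have hz' : π z = x.1 := by
        have := hyz.map π.continuous
        rw [hπy] at this
        exact (this.mem_closed x.2 rfl)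
      have hzV : z ∈ π ⁻¹ᵁ U := by
        show π z ∈ U
        rwa [hz']
      have hz₁ := hV.fromSpec_primeIdealOf ⟨z, hzV⟩
      replace hyz : hV.fromSpec q₀ ⤳ hV.fromSpec (hV.primeIdealOf ⟨z, hzV⟩) := by
        rw [hz₁]
        exact hyz
      replace hyz : q₀ ≤ hV.primeIdealOf ⟨z, hzV⟩ := (PrimeSpectrum.le_iff_specializes _ _).2
        (hV.fromSpec.isOpenEmbedding.isInducing.specializes_iff.1 hyz)
      have : q₀ = hV.primeIdealOf ⟨z, hzV⟩ :=
        PrimeSpectrum.ext (hqm.eq_of_le (hV.primeIdealOf ⟨z, hzV⟩).2.ne_top hyz)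
      rw [Set.mem_singleton_iff]
      show z = hV.fromSpec q₀
      rw [this, hz₁]
    refine ⟨⟨⟨y, hclosed⟩, Subtype.ext hπy⟩, Subtype.ext ?_⟩
    exact congrArg PrimeSpectrum.asIdeal hy

theorem ramificationIdx_inertiaDeg_primeIdealOf [Flat π] [IsDomain Γ(Y, U)]
    (hU₀ : ¬ IsField Γ(Y, U)) (y : X) (hyc : IsClosed {y}) (hx : π y ∈ U)
    [IsDomain (X.presheaf.stalk y)] [IsPrincipalIdealRing (X.presheaf.stalk y)] :
    letI := (π.app U).hom.toAlgebra
    letI q := ((hU.preimage π).primeIdealOf ⟨y, hx⟩).asIdeal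
    q.ramificationIdx Γ(Y, U) = ramIdx π y ∧ q.inertiaDeg Γ(Y, U) = π.residueDegree y := by
  have hV := hU.preimage π
  let := (π.app U).hom.toAlgebra
  let p := (hU.primeIdealOf ⟨π y, hx⟩).asIdeal
  let q := (hV.primeIdealOf ⟨y, hx⟩).asIdeal
  have hpm : p.IsMaximal := hU.primeIdealOf_isMaximal_of_isClosed ⟨π y, hx⟩
    (by simpa using π.isClosedMap _ hyc)
  have hqm : q.IsMaximal := hV.primeIdealOf_isMaximal_of_isClosed ⟨y, hx⟩ hyc
  have hp₀ : p ≠ ⊥ := fun h => hU₀ (Ring.isField_iff_maximal_bot.2 (h ▸ hpm))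
  have : q.LiesOver p := by
    have h := IsAffineOpen.comap_primeIdealOf_appLE U hU _ hV le_rfl hx
    rw [← Scheme.Hom.app_eq_appLE] at h
    exact ⟨congrArg PrimeSpectrum.asIdeal h.symm⟩
  show q.ramificationIdx Γ(Y, U) = ramIdx π y ∧ q.inertiaDeg Γ(Y, U) = π.residueDegree y
  let : Algebra Γ(Y, U) (Y.presheaf.stalk (π y)) :=
    (Y.presheaf.germ U (π y) hx).hom.toAlgebra
  let : Algebra Γ(X, π ⁻¹ᵁ U) (X.presheaf.stalk y) :=
    (X.presheaf.germ (π ⁻¹ᵁ U) y hx).hom.toAlgebra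
  let : Algebra (Y.presheaf.stalk (π y)) (X.presheaf.stalk y) :=
    (π.stalkMap y).hom.toAlgebra
  let : Algebra Γ(Y, U) (X.presheaf.stalk y) :=
    ((X.presheaf.germ (π ⁻¹ᵁ U) y hx).hom.comp (π.app U).hom).toAlgebra
  have : IsScalarTower Γ(Y, U) Γ(X, π ⁻¹ᵁ U) (X.presheaf.stalk y) :=
    .of_algebraMap_eq fun _ => rfl
  have : IsScalarTower Γ(Y, U) (Y.presheaf.stalk (π y)) (X.presheaf.stalk y) :=
    .of_algebraMap_eq fun r => (π.germ_stalkMap_apply U y hx r).symm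
  have : IsLocalization.AtPrime (Y.presheaf.stalk (π y)) p :=
    hU.isLocalization_stalk ⟨π y, hx⟩
  have : IsLocalization.AtPrime (X.presheaf.stalk y) q :=
    hV.isLocalization_stalk ⟨y, hx⟩
  have : Module.Flat (Y.presheaf.stalk (π y)) (X.presheaf.stalk y) := Flat.stalkMap π y
  have hloc : IsLocalHom (algebraMap (Y.presheaf.stalk (π y)) (X.presheaf.stalk y)) :=
    inferInstanceAs (IsLocalHom (π.stalkMap y).hom)
  -- A flat local homomorphism is faithfully flat, hence injective. The extended maximal ideal is
  -- then nonzero because `p ≠ ⊥`.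
  have : Module.FaithfullyFlat (Y.presheaf.stalk (π y)) (X.presheaf.stalk y) :=
    Module.FaithfullyFlat.of_flat_of_isLocalHom
  have hinj : Function.Injective
      (algebraMap (Y.presheaf.stalk (π y)) (X.presheaf.stalk y)) :=
    FaithfulSMul.algebraMap_injective _ _
  have hmap : (maximalIdeal (Y.presheaf.stalk (π y))).map
      (algebraMap (Y.presheaf.stalk (π y)) (X.presheaf.stalk y)) ≠ ⊥ := by
    rw [Ne, Ideal.map_eq_bot_iff_of_injective hinj]
    intro h
    have h' := IsLocalization.AtPrime.under_maximalIdeal (Y.presheaf.stalk (π y)) p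
    rw [h] at h'
    apply hp₀
    rw [← h']
    exact (RingHom.injective_iff_ker_eq_bot _).1
      (IsLocalization.injective (Y.presheaf.stalk (π y)) p.primeCompl_le_nonZeroDivisors)
  refine ⟨ramificationIdx_eq_maximalIdeal p q hmap,
    (inertiaDeg_eq_residueField (A := Y.presheaf.stalk (π y)) (B := X.presheaf.stalk y) p q).trans
      ?_⟩
  unfold Scheme.Hom.residueDegree
  congr 1
  refine Module.ext' _ _ fun r z => ?_
  obtain ⟨r, rfl⟩ := IsLocalRing.residue_surjective r
  obtain ⟨z, rfl⟩ := IsLocalRing.residue_surjective z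
  rfl

open Classical in
include hU in
/-- The fundamental identity `∑ e f = n` for a finite flat morphism to a curve. -/
theorem exists_finset_sum_ramIdx_mul_residueDegree [Flat π] [IsDomain Γ(Y, U)]
    [∀ y : X, IsDomain (X.presheaf.stalk y)] [∀ y : X, IsPrincipalIdealRing (X.presheaf.stalk y)]
    (x : ClosedPt Y) (hx : x.1 ∈ U) (hU₀ : ¬ IsField Γ(Y, U)) :
    ∃ F : Finset (ClosedPt X), (∀ y, y ∈ F ↔ mapClosedPt π y = x) ∧
      (∀ y ∈ F, 0 < ramIdx π y.1 ∧ 0 < π.residueDegree y.1) ∧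
      ∑ y ∈ F, ramIdx π y.1 * π.residueDegree y.1 =
        letI := (π.app U).hom.toAlgebra
        Module.finrank Γ(Y, U) Γ(X, π ⁻¹ᵁ U) := by
  have hV := hU.preimage π
  let := (π.app U).hom.toAlgebra
  obtain ⟨E, hE⟩ := primesOver_preimage_bijective π hU x hx
  have : Module.Finite Γ(Y, U) Γ(X, π ⁻¹ᵁ U) := IsFinite.finite_app π U hU
  have : Module.Flat Γ(Y, U) Γ(X, π ⁻¹ᵁ U) := by
    have h := Flat.flat_appLE π hU hV le_rfl
    rwa [← Scheme.Hom.app_eq_appLE] at h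
  let p := (hU.primeIdealOf ⟨x.1, hx⟩).asIdeal
  have hpm : p.IsMaximal := hU.primeIdealOf_isMaximal_of_isClosed _ x.2
  have hfin : Finite (p.primesOver Γ(X, π ⁻¹ᵁ U)) :=
    Finite.of_equiv _ (PrimeSpectrum.primesOverOrderIsoFiber Γ(Y, U) Γ(X, π ⁻¹ᵁ U) p).symm.toEquiv
  let : Fintype (p.primesOver Γ(X, π ⁻¹ᵁ U)) := Fintype.ofFinite _
  let : Fintype {y : ClosedPt X // mapClosedPt π y = x} := Fintype.ofEquiv _ E.symm
  have key (y : {y : ClosedPt X // mapClosedPt π y = x}) :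
      (E y).1.ramificationIdx Γ(Y, U) = ramIdx π y.1.1 ∧
      (E y).1.inertiaDeg Γ(Y, U) = π.residueDegree y.1.1 := by
    have hy : π y.1.1 ∈ U := by
      have h : π y.1.1 = x.1 := congrArg Subtype.val y.2
      rwa [h]
    rw [hE y hy]
    exact ramificationIdx_inertiaDeg_primeIdealOf π hU hU₀ y.1.1 y.1.2 hy
  refine ⟨(Finset.univ : Finset {y : ClosedPt X // mapClosedPt π y = x}).map
    (Function.Embedding.subtype _), ?_, ?_, ?_⟩
  · intro y
    simp
  · intro y hy
    rw [Finset.mem_map] at hy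
    obtain ⟨y, -, rfl⟩ := hy
    have := (E y).2.1
    rw [Function.Embedding.subtype_apply, ← (key y).1, ← (key y).2]
    exact ⟨Ideal.ramificationIdx_pos _ _, Ideal.inertiaDeg_pos _ _⟩
  · rw [Finset.sum_map, ← Ideal.sum_ramification_inertia_eq_finrank p, ← E.sum_comp]
    exact Finset.sum_congr rfl fun y _ => by
      rw [(key y).1, (key y).2]
      rfl

end Fibre

end

noncomputable section

/-! ### Ramified, inert and split fibres -/

section Trichotomy

theorem Finset.trichotomy_of_sum_mul_eq_two {ι : Type*} (F : Finset ι) (e f : ι → ℕ)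
    (hpos : ∀ y ∈ F, 0 < e y ∧ 0 < f y) (hsum : ∑ y ∈ F, e y * f y = 2) :
    (∃ y, F = {y} ∧ e y = 2 ∧ f y = 1) ∨ (∃ y, F = {y} ∧ e y = 1 ∧ f y = 2) ∨
      ∃ y z, y ≠ z ∧ (∀ w, w ∈ F ↔ w = y ∨ w = z) ∧ e y = 1 ∧ f y = 1 ∧ e z = 1 ∧ f z = 1 := by
  classical
  have hle (y) (hy : y ∈ F) : 1 ≤ e y * f y := Nat.mul_pos (hpos y hy).1 (hpos y hy).2
  have hcard : F.card ≤ 2 := by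
    rw [← hsum, Finset.card_eq_sum_ones]
    exact Finset.sum_le_sum hle
  obtain h | h | h : F.card = 0 ∨ F.card = 1 ∨ F.card = 2 := by omega
  · rw [Finset.card_eq_zero] at h
    simp [h] at hsum
  · obtain ⟨y, rfl⟩ := Finset.card_eq_one.1 h
    rw [Finset.sum_singleton] at hsum
    have hf : f y ∣ 2 := ⟨e y, by rw [← hsum, mul_comm]⟩
    obtain h | h := (Nat.dvd_prime Nat.prime_two).1 hf
    · exact .inl ⟨y, rfl, by simpa [h] using hsum, h⟩
    · exact .inr (.inl ⟨y, rfl, by rw [h] at hsum; omega, h⟩)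
  · obtain ⟨y, z, hyz, rfl⟩ := Finset.card_eq_two.1 h
    rw [Finset.sum_pair hyz] at hsum
    have h₁ := hle y (by simp)
    have h₂ := hle z (by simp)
    have h₃ : e y * f y = 1 := by omega
    have h₄ : e z * f z = 1 := by omega
    rw [mul_eq_one] at h₃ h₄
    exact .inr (.inr ⟨y, z, hyz, by simp, h₃.1, h₃.2, h₄.1, h₄.2⟩)

variable {X Y : Scheme.{u}} (π : X ⟶ Y) [UniversallyClosed π]

/-- The three solutions of `∑ e f = 2` in positive integers are, in order, the ramified, inert and
split fibres. -/
theorem isDoubleCover_of_sum_eq_two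
    (h : ∀ x : ClosedPt Y, ∃ F : Finset (ClosedPt X), (∀ y, y ∈ F ↔ mapClosedPt π y = x) ∧
      (∀ y ∈ F, 0 < ramIdx π y.1 ∧ 0 < π.residueDegree y.1) ∧
      ∑ y ∈ F, ramIdx π y.1 * π.residueDegree y.1 = 2) :
    IsDoubleCover (mapClosedPt π) (fun y => π.residueDegree y.1) (IsRamifiedPt π)
      (IsSplitPt π) (IsInertPt π) := by
  have key (x : ClosedPt Y) :
      ((IsRamifiedPt π x ∧ ¬ IsSplitPt π x ∧ ¬ IsInertPt π x) ∧
        ∃ y : ClosedPt X, π.residueDegree y.1 = 1 ∧ ∀ z, mapClosedPt π z = x ↔ z = y) ∨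
      ((¬ IsRamifiedPt π x ∧ ¬ IsSplitPt π x ∧ IsInertPt π x) ∧
        ∃ y : ClosedPt X, π.residueDegree y.1 = 2 ∧ ∀ z, mapClosedPt π z = x ↔ z = y) ∨
      ((¬ IsRamifiedPt π x ∧ IsSplitPt π x ∧ ¬ IsInertPt π x) ∧
        ∃ y y' : ClosedPt X, y ≠ y' ∧ π.residueDegree y.1 = 1 ∧ π.residueDegree y'.1 = 1 ∧
          ∀ z, mapClosedPt π z = x ↔ z = y ∨ z = y') := by
    obtain ⟨F, hF, hpos, hsum⟩ := h x
    obtain ⟨y, rfl, he, hf⟩ | ⟨y, rfl, he, hf⟩ | ⟨y, z, hyz, hF', hey, hfy, hez, hfz⟩ :=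
      F.trichotomy_of_sum_mul_eq_two _ _ hpos hsum
    · simp only [Finset.mem_singleton] at hF
      have hy := (hF y).1 rfl
      have hR : IsRamifiedPt π x := ⟨y, hy, by omega⟩
      exact .inl ⟨⟨hR, fun hS => by have := (hS y hy).1; omega, fun hI => hI.1 hR⟩,
        y, hf, fun z => (hF z).symm⟩
    · simp only [Finset.mem_singleton] at hF
      have hy := (hF y).1 rfl
      have hR : ¬ IsRamifiedPt π x := by
        rintro ⟨z, hz, hz'⟩
        rw [← hF] at hz
        rw [hz] at hz'
        omega
      exact .inr (.inl ⟨⟨hR, fun hS => by have := (hS y hy).2; omega,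
        hR, y, hy, fun z hz => (hF z).2 hz⟩, y, hf, fun z => (hF z).symm⟩)
    · have hF'' (w) : mapClosedPt π w = x ↔ w = y ∨ w = z := (hF w).symm.trans (hF' w)
      have hR : ¬ IsRamifiedPt π x := by
        rintro ⟨w, hw, hw'⟩
        obtain rfl | rfl := (hF'' w).1 hw <;> omega
      refine .inr (.inr ⟨⟨hR, fun w hw => ?_, fun hI => ?_⟩, y, z, hyz, hfy, hfz, hF''⟩)
      · obtain rfl | rfl := (hF'' w).1 hw
        exacts [⟨hey, hfy⟩, ⟨hez, hfz⟩]
      · exact hyz (hI.2.unique ((hF'' y).2 (.inl rfl)) ((hF'' z).2 (.inr rfl)))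
  constructor <;> intro x <;> have := key x <;> tauto

end Trichotomy

end

noncomputable section

/-! ### Charts and topology of the projective line -/

section ProjectiveLine

attribute [local instance] MvPolynomial.gradedAlgebra

open MvPolynomial

namespace P1

variable {k : Type u} [Field k]

theorem X_mem_homogeneousSubmodule (i : Fin 2) :
    (X i : MvPolynomial (Fin 2) k) ∈ homogeneousSubmodule (Fin 2) k 1 :=
  (mem_homogeneousSubmodule 1 _).2 (isHomogeneous_X k i)

/-- The homomorphism from the coordinate ring of `D₊(Xᵢ)` to a `k`-algebra that sends `F / Xᵢⁿ` to
`F(v)`, where `vᵢ = 1`. -/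
def evalAway {B : Type u} [CommRing B] [Algebra k B] (i : Fin 2) (v : Fin 2 → B) (hv : v i = 1) :
    HomogeneousLocalization.Away (homogeneousSubmodule (Fin 2) k) (X i) →+* B :=
  (IsLocalization.Away.lift (S := Localization.Away (X i : MvPolynomial (Fin 2) k))
    (X i) (g := (aeval v : MvPolynomial (Fin 2) k →ₐ[k] B).toRingHom) (by simp [hv])).comp
  (algebraMap _ (Localization.Away (X i : MvPolynomial (Fin 2) k)))

theorem evalChart_eq {B : Type u} [CommRing B] [Algebra k B] (b : B) :
    evalChart (k := k) b = evalAway 1 ![b, 1] rfl :=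
  rfl

theorem evalAway_mk {B : Type u} [CommRing B] [Algebra k B] (i : Fin 2) (v : Fin 2 → B)
    (hv : v i = 1) (n : ℕ) (a : MvPolynomial (Fin 2) k)
    (ha : a ∈ homogeneousSubmodule (Fin 2) k (n • 1)) :
    evalAway i v hv (.mk _ (X_mem_homogeneousSubmodule i) n a ha) = aeval v a := by
  have h : (HomogeneousLocalization.Away.mk _ (X_mem_homogeneousSubmodule i) n a ha).val *
      algebraMap (MvPolynomial (Fin 2) k) (Localization.Away (X i)) (X i ^ n) =
        algebraMap (MvPolynomial (Fin 2) k) (Localization.Away (X i)) a := by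
    rw [HomogeneousLocalization.Away.val_mk, ← Localization.mk_one_eq_algebraMap,
      ← Localization.mk_one_eq_algebraMap, Localization.mk_mul, Localization.mk_eq_mk_iff,
      Localization.r_iff_exists]
    exact ⟨1, by simp; ring⟩
  have h' := congrArg (IsLocalization.Away.lift (S := Localization.Away (X i : MvPolynomial (Fin 2) k))
    (X i) (g := (aeval v : MvPolynomial (Fin 2) k →ₐ[k] B).toRingHom) (by simp [hv])) h
  rw [map_mul, IsLocalization.Away.lift_eq, IsLocalization.Away.lift_eq] at h'
  simp only [AlgHom.toRingHom_eq_coe, RingHom.coe_coe, map_pow, aeval_X, hv, one_pow,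
    mul_one] at h'
  exact h'

theorem comp_evalAway {B B' : Type u} [CommRing B] [Algebra k B] [CommRing B'] [Algebra k B']
    (φ : B →ₐ[k] B') (i : Fin 2) (v : Fin 2 → B) (hv : v i = 1) :
    φ.toRingHom.comp (evalAway (k := k) i v hv) = evalAway (k := k) i (φ ∘ v) (show φ (v i) = 1 by simp [hv]) := by
  ext z
  obtain ⟨n, a, ha, rfl⟩ := HomogeneousLocalization.Away.mk_surjective _
    (X_mem_homogeneousSubmodule i) z
  rw [RingHom.comp_apply, evalAway_mk, evalAway_mk]
  exact comp_aeval_apply v φ a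

-- Dehomogenization loses nothing in fixed degree `n`: the exponent of `X j` determines that of `X
-- i`, so distinct monomials have distinct images. Constants and `X j / X i` generate the target.
open Polynomial in
theorem evalAway_bijective (i j : Fin 2) (hij : i ≠ j) (v : Fin 2 → k[X]) (hi : v i = 1)
    (hj : v j = Polynomial.X) : Function.Bijective (evalAway (k := k) i v hi) := by
  have huniv : (Finset.univ : Finset (Fin 2)) = {i, j} := by
    have : ∀ i j : Fin 2, i ≠ j → Finset.univ = {i, j} := by decide
    exact this i j hij
  constructor
  · rw [injective_iff_map_eq_zero]
    intro z hz
    obtain ⟨n, a, ha, rfl⟩ := HomogeneousLocalization.Away.mk_surjective _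
      (X_mem_homogeneousSubmodule i) z
    rw [evalAway_mk] at hz
    have ha' : a.IsHomogeneous n := by simpa using (mem_homogeneousSubmodule _ _).1 ha
    have hdeg (d : Fin 2 →₀ ℕ) (hd : d ∈ a.support) : d i + d j = n := by
      have := ha' (mem_support_iff.1 hd)
      rw [Finsupp.weight_apply, Finsupp.sum_fintype _ _ (by simp), huniv,
        Finset.sum_pair hij] at this
      simpa using this
    have ha₀ : a = 0 := by
      ext d
      rw [MvPolynomial.coeff_zero]
      by_contra hd
      have hd' : d ∈ a.support := mem_support_iff.2 hd
      have h := congrArg (fun P : k[X] => P.coeff (d j)) hz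
      simp only [MvPolynomial.aeval_def, eval₂_eq', huniv, Finset.prod_pair hij, hi, hj, one_pow, one_mul,
        Polynomial.coeff_zero, Polynomial.finsetSum_coeff, ← Polynomial.C_eq_algebraMap,
        Polynomial.coeff_C_mul, Polynomial.coeff_X_pow] at h
      rw [Finset.sum_eq_single d] at h
      · simp at h
        exact hd h
      · intro e he hed
        rw [if_neg, mul_zero]
        intro h
        apply hed
        ext l
        have hl : l ∈ ({i, j} : Finset (Fin 2)) := huniv ▸ Finset.mem_univ l
        have := hdeg d hd'
        have := hdeg e he
        obtain rfl | hl := Finset.mem_insert.1 hl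
        · omega
        · rw [Finset.mem_singleton.1 hl, h]
      · exact fun h => absurd hd' h
    subst ha₀
    ext
    rw [HomogeneousLocalization.Away.val_mk, HomogeneousLocalization.val_zero,
      Localization.mk_zero]
  · intro P
    induction P using Polynomial.induction_on with
    | C c =>
      refine ⟨.mk _ (X_mem_homogeneousSubmodule i) 0 (C c) ?_, ?_⟩
      · simp
      · rw [evalAway_mk]
        simp
    | add P Q hP hQ =>
      obtain ⟨p, rfl⟩ := hP
      obtain ⟨q, rfl⟩ := hQ
      exact ⟨p + q, map_add _ _ _⟩
    | monomial n c h =>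
      obtain ⟨p, hp⟩ := h
      refine ⟨p * .mk _ (X_mem_homogeneousSubmodule i) 1 (X j)
        (by simpa using isHomogeneous_X k j), ?_⟩
      · rw [map_mul, hp, evalAway_mk, MvPolynomial.aeval_X, hj, pow_succ, mul_assoc]

open Polynomial in
/-- The coordinate ring of a standard affine chart is a polynomial ring. -/
def awayEquiv (i : Fin 2) :
    HomogeneousLocalization.Away (homogeneousSubmodule (Fin 2) k) (X i) ≃+* k[X] :=
  RingEquiv.ofBijective
    (evalAway i (fun l => if l = i then 1 else Polynomial.X) (if_pos rfl))
    (evalAway_bijective i (1 - i) (by revert i; decide) _ _ (if_neg (by revert i; decide)))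

variable (k) in
/-- The standard affine charts of the projective line. -/
def U (i : Fin 2) : (P1 k).Opens := Proj.basicOpen (homogeneousSubmodule (Fin 2) k) (X i)

theorem isAffineOpen_U (i : Fin 2) : IsAffineOpen (U k i) :=
  Proj.isAffineOpen_basicOpen _ _ (X_mem_homogeneousSubmodule i) one_pos

open Polynomial in
/-- The coordinate ring of a standard affine chart is a polynomial ring. -/
def sectionsEquiv (i : Fin 2) : Γ(P1 k, U k i) ≃+* k[X] :=
  ((Proj.basicOpenIsoAway _ _ (X_mem_homogeneousSubmodule i)
    one_pos).commRingCatIsoToRingEquiv.symm).trans (awayEquiv i)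

instance (i : Fin 2) : IsDomain Γ(P1 k, U k i) := (sectionsEquiv i).toMulEquiv.isDomain _

instance (i : Fin 2) : IsPrincipalIdealRing Γ(P1 k, U k i) :=
  IsPrincipalIdealRing.of_surjective (sectionsEquiv i).symm.toRingHom
    (sectionsEquiv i).symm.surjective

theorem not_isField (i : Fin 2) : ¬ IsField Γ(P1 k, U k i) := fun h =>
  Polynomial.not_isField k ((sectionsEquiv i).symm.toMulEquiv.isField h)

theorem iSup_U : ⨆ i, U k i = ⊤ := by
  apply Proj.iSup_basicOpen_eq_top'
  · exact fun i => ⟨1, X_mem_homogeneousSubmodule i⟩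
  · rw [← top_le_iff]
    intro a _
    induction a using MvPolynomial.induction_on with
    | C c => exact Subalgebra.algebraMap_mem _ (⟨C c, isHomogeneous_C (Fin 2) c⟩ :
        homogeneousSubmodule (Fin 2) k 0)
    | add p q hp hq => exact add_mem (hp trivial) (hq trivial)
    | mul_X p i hp => exact mul_mem (hp trivial) (Algebra.subset_adjoin ⟨i, rfl⟩)

theorem exists_mem_U (x : P1 k) : ∃ i, x ∈ U k i := by
  have : x ∈ ⨆ i, U k i := iSup_U (k := k) ▸ trivial
  simpa using this

instance : IsOpenImmersion (chart k) :=
  inferInstanceAs (IsOpenImmersion (Proj.awayι _ _ _ _))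

theorem opensRange_chart : (chart k).opensRange = U k 1 :=
  Proj.opensRange_awayι _ _ _ _

/-- Reducedness of the target makes a dominant morphism scheme-theoretically dominant, hence
injective on sections. -/
instance : IsReduced (P1 k) := by
  have (x : P1 k) : _root_.IsReduced ((P1 k).presheaf.stalk x) := by
    obtain ⟨i, hi⟩ := exists_mem_U x
    let := ((P1 k).presheaf.germ (U k i) x hi).hom.toAlgebra
    have : IsLocalization.AtPrime ((P1 k).presheaf.stalk x)
      ((isAffineOpen_U i).primeIdealOf ⟨x, hi⟩).asIdeal :=
        (isAffineOpen_U i).isLocalization_stalk ⟨x, hi⟩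
    have := IsLocalization.isDomain_of_atPrime ((P1 k).presheaf.stalk x)
      ((isAffineOpen_U i).primeIdealOf ⟨x, hi⟩).asIdeal
    infer_instance
  exact isReduced_of_isReduced_stalk _

/-- The generic point of the projective line. -/
def generic : P1 k :=
  { asHomogeneousIdeal := ⊥
    isPrime := by
      rw [HomogeneousIdeal.toIdeal_bot]
      exact Ideal.isPrime_bot
    not_irrelevant_le := by
      intro h
      have h₀ : (X 0 : MvPolynomial (Fin 2) k) ∈
          (⊥ : HomogeneousIdeal (homogeneousSubmodule (Fin 2) k)) := by
        apply h
        rw [HomogeneousIdeal.mem_irrelevant_iff, GradedRing.proj_apply,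
          DirectSum.decompose_of_mem_ne _ (X_mem_homogeneousSubmodule 0) one_ne_zero]
      rw [← HomogeneousIdeal.mem_iff, HomogeneousIdeal.toIdeal_bot, Ideal.mem_bot] at h₀
      exact X_ne_zero (R := k) (0 : Fin 2) h₀ }

/-- A nonempty basic open set is given by a nonzero `f`, which the zero ideal does not contain. -/
theorem dense_generic : Dense ({generic} : Set (P1 k)) := by
  have hb := ProjectiveSpectrum.isTopologicalBasis_basic_opens (homogeneousSubmodule (Fin 2) k)
  refine hb.dense_iff.2 ?_
  rintro _ ⟨f, rfl⟩ ⟨x, hx⟩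
  refine ⟨generic, fun hf => hx ?_, rfl⟩
  have hf₀ : f ∈ (⊥ : HomogeneousIdeal (homogeneousSubmodule (Fin 2) k)) := hf
  rw [← HomogeneousIdeal.mem_iff, HomogeneousIdeal.toIdeal_bot, Ideal.mem_bot] at hf₀
  rw [hf₀]
  exact zero_mem x.asHomogeneousIdeal.toIdeal

theorem generic_mem_U (i : Fin 2) : generic ∈ U k i := by
  intro h
  have h₀ : (X i : MvPolynomial (Fin 2) k) ∈
      (⊥ : HomogeneousIdeal (homogeneousSubmodule (Fin 2) k)) := h
  rw [← HomogeneousIdeal.mem_iff, HomogeneousIdeal.toIdeal_bot, Ideal.mem_bot] at h₀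
  exact X_ne_zero (R := k) i h₀

instance : IrreducibleSpace (P1 k) where
  toNonempty := ⟨generic⟩
  isPreirreducible_univ := by
    rw [← dense_generic.closure_eq]
    exact isPreirreducible_singleton.closure

instance : Algebra.FiniteType (homogeneousSubmodule (Fin 2) k 0) (MvPolynomial (Fin 2) k) :=
  have : IsScalarTower k (homogeneousSubmodule (Fin 2) k 0) (MvPolynomial (Fin 2) k) :=
    ⟨fun c a b => smul_mul_assoc c (a : MvPolynomial (Fin 2) k) b⟩
  Algebra.FiniteType.of_restrictScalars_finiteType k _ _

theorem algebraMap_zero_surjective :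
    Function.Surjective (algebraMap k (homogeneousSubmodule (Fin 2) k 0)) := by
  rintro ⟨a, ha⟩
  have h := ((mem_homogeneousSubmodule _ _).1 ha).totalDegree_le
  exact ⟨coeff 0 a, Subtype.ext (totalDegree_eq_zero_iff_eq_C.1 (Nat.le_zero.1 h)).symm⟩

instance : LocallyOfFiniteType (toSpec k) := by
  have : LocallyOfFiniteType (Spec.map (CommRingCat.ofHom
      (algebraMap k (homogeneousSubmodule (Fin 2) k 0)))) := by
    rw [HasRingHomProperty.Spec_iff (P := @LocallyOfFiniteType)]
    exact RingHom.FiniteType.of_surjective _ algebraMap_zero_surjective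
  exact MorphismProperty.comp_mem @LocallyOfFiniteType
    (Proj.toSpecZero (homogeneousSubmodule (Fin 2) k)) _ inferInstance this

instance : QuasiCompact (toSpec k) :=
  MorphismProperty.comp_mem @QuasiCompact
    (Proj.toSpecZero (homogeneousSubmodule (Fin 2) k))
    (Spec.map (CommRingCat.ofHom (algebraMap k (homogeneousSubmodule (Fin 2) k 0))))
    inferInstance inferInstance

end P1

end ProjectiveLine

end

noncomputable section

/-! ### Flatness and rank on affine charts -/

section FlatRank

variable {X Y : Scheme.{u}} (π : X ⟶ Y)

theorem flat_of_flat_app [IsAffineHom π] {ι : Type*} (U : ι → Y.Opens) (hU : ∀ i, IsAffineOpen (U i))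
    (hcover : ∀ y, ∃ i, y ∈ U i) (hflat : ∀ i, (π.app (U i)).hom.Flat) : Flat π := by
  refine Flat.of_stalkMap π fun x => ?_
  obtain ⟨i, hx⟩ := hcover (π x)
  have hV := (hU i).preimage π
  let := (π.app (U i)).hom.toAlgebra
  let : Algebra Γ(Y, U i) (Y.presheaf.stalk (π x)) :=
    (Y.presheaf.germ (U i) (π x) hx).hom.toAlgebra
  let : Algebra Γ(X, π ⁻¹ᵁ U i) (X.presheaf.stalk x) :=
    (X.presheaf.germ (π ⁻¹ᵁ U i) x hx).hom.toAlgebra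
  let : Algebra (Y.presheaf.stalk (π x)) (X.presheaf.stalk x) :=
    (π.stalkMap x).hom.toAlgebra
  let : Algebra Γ(Y, U i) (X.presheaf.stalk x) :=
    ((X.presheaf.germ (π ⁻¹ᵁ U i) x hx).hom.comp (π.app (U i)).hom).toAlgebra
  have : IsScalarTower Γ(Y, U i) Γ(X, π ⁻¹ᵁ U i) (X.presheaf.stalk x) :=
    .of_algebraMap_eq fun _ => rfl
  have : IsScalarTower Γ(Y, U i) (Y.presheaf.stalk (π x)) (X.presheaf.stalk x) :=
    .of_algebraMap_eq fun r => (π.germ_stalkMap_apply (U i) x hx r).symm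
  have : IsLocalization.AtPrime (Y.presheaf.stalk (π x)) ((hU i).primeIdealOf ⟨π x, hx⟩).asIdeal :=
    (hU i).isLocalization_stalk ⟨π x, hx⟩
  have : IsLocalization.AtPrime (X.presheaf.stalk x) (hV.primeIdealOf ⟨x, hx⟩).asIdeal :=
    hV.isLocalization_stalk ⟨x, hx⟩
  have : Module.Flat Γ(Y, U i) Γ(X, π ⁻¹ᵁ U i) := hflat i
  have : Module.Flat Γ(X, π ⁻¹ᵁ U i) (X.presheaf.stalk x) :=
    IsLocalization.flat _ (hV.primeIdealOf ⟨x, hx⟩).asIdeal.primeCompl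
  have := Module.Flat.trans Γ(Y, U i) Γ(X, π ⁻¹ᵁ U i) (X.presheaf.stalk x)
  exact (Module.flat_iff_of_isLocalization (Y.presheaf.stalk (π x))
    ((hU i).primeIdealOf ⟨π x, hx⟩).asIdeal.primeCompl _).2 this

theorem isPullback_fromSpec_preimage [IsAffineHom π] {U : Y.Opens} (hU : IsAffineOpen U) :
    IsPullback (hU.preimage π).fromSpec (Spec.map (π.app U)) π hU.fromSpec := by
  refine (IsOpenImmersion.isPullback _ _ _ _ ?_ ?_).flip
  · rw [Scheme.Hom.app_eq_appLE]
    exact (hU.SpecMap_appLE_fromSpec π (hU.preimage π) le_rfl).symm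
  · ext1
    simp

/-- Over a domain the fibre dimension of a finite flat algebra equals its generic rank, so the
right-hand side does not depend on `y`. -/
theorem finrank_eq_finrank_app [IsFinite π] [Flat π] {U : Y.Opens} (hU : IsAffineOpen U)
    [IsDomain Γ(Y, U)] (y : Y) (hy : y ∈ U) :
    π.finrank y =
      letI := (π.app U).hom.toAlgebra
      Module.finrank Γ(Y, U) Γ(X, π ⁻¹ᵁ U) := by
  let := (π.app U).hom.toAlgebra
  have : Module.Finite Γ(Y, U) Γ(X, π ⁻¹ᵁ U) := IsFinite.finite_app π U hU
  have : Module.Flat Γ(Y, U) Γ(X, π ⁻¹ᵁ U) := by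
    have h := Flat.flat_appLE π hU (hU.preimage π) le_rfl
    rwa [← Scheme.Hom.app_eq_appLE] at h
  have h := Scheme.Hom.finrank_of_isPullback _ _ _ _ (isPullback_fromSpec_preimage π hU)
    (hU.primeIdealOf ⟨y, hy⟩)
  rw [hU.fromSpec_primeIdealOf] at h
  rw [← h]
  refine (Scheme.Hom.finrank_SpecMap_algebraMap _ _ _).trans ?_
  rw [← Ideal.finrank_fiber_eq_finrank (hU.primeIdealOf ⟨y, hy⟩).asIdeal,
    Ideal.finrank_fiber_eq_rankAtStalk]

end FlatRank

/-! ### The hyperelliptic map is finite flat of degree 2 -/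

section Hyperelliptic

open Polynomial

attribute [local instance] MvPolynomial.gradedAlgebra

variable {k : Type u} [Field k] {C : Scheme.{u}} (π : C ⟶ P1 k)

/-- Functions on each chart inject into the domain of functions on its preimage, which is therefore
torsion-free over a principal ideal domain, hence flat. -/
theorem flat_of_surjective [IsAffineHom π] [IsIntegral C] (h : Function.Surjective π) : Flat π := by
  have : Surjective π := ⟨h⟩
  have : IsSchemeTheoreticallyDominant π := .of_isDominant π
  refine flat_of_flat_app π (P1.U k) P1.isAffineOpen_U P1.exists_mem_U fun i => ?_
  let := (π.app (P1.U k i)).hom.toAlgebra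
  have hinj : Function.Injective (π.app (P1.U k i)) := π.app_injective _
  have hne : Nonempty (π ⁻¹ᵁ P1.U k i) := by
    obtain ⟨x, hx⟩ := h P1.generic
    exact ⟨⟨x, show π x ∈ P1.U k i from hx ▸ P1.generic_mem_U i⟩⟩
  have : FaithfulSMul Γ(P1 k, P1.U k i) Γ(C, π ⁻¹ᵁ P1.U k i) :=
    (faithfulSMul_iff_algebraMap_injective _ _).2 hinj
  have : Module.IsTorsionFree Γ(P1 k, P1.U k i) Γ(C, π ⁻¹ᵁ P1.U k i) := inferInstance
  exact (inferInstance : Module.Flat Γ(P1 k, P1.U k i) Γ(C, π ⁻¹ᵁ P1.U k i))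

theorem isPullback_adjoinRoot (P : k[X][X]) (ι : Spec (.of (AdjoinRoot P)) ⟶ C)
    (h : IsPullback ι
      (Spec.map (CommRingCat.ofHom (P1.evalChart (AdjoinRoot.of P X)))) π (P1.chart k)) :
    IsPullback ι (Spec.map (CommRingCat.ofHom (algebraMap k[X] (AdjoinRoot P)))) π
      (Spec.map (P1.awayEquiv (k := k) 1).toCommRingCatIso.hom ≫ P1.chart k) := by
  have hφ : P1.evalChart (AdjoinRoot.of P X) =
      (algebraMap k[X] (AdjoinRoot P)).comp (P1.awayEquiv (k := k) 1).toRingHom := by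
    refine Eq.trans ?_ (P1.comp_evalAway (IsScalarTower.toAlgHom k k[X] (AdjoinRoot P)) 1 _
      (if_pos rfl)).symm
    rw [P1.evalChart_eq]
    congr 1
    ext i
    fin_cases i <;> simp
  have hsq : IsPullback (𝟙 _) (Spec.map (CommRingCat.ofHom (algebraMap k[X] (AdjoinRoot P))))
      (Spec.map (CommRingCat.ofHom (P1.evalChart (AdjoinRoot.of P X))))
      (Spec.map (P1.awayEquiv (k := k) 1).toCommRingCatIso.hom) := by
    refine IsPullback.of_horiz_isIso ⟨?_⟩
    rw [Category.id_comp, ← Spec.map_comp, hφ]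
    rfl
  simpa using hsq.paste_horiz h

theorem natDegree_hyperelliptic (f h : k[X]) :
    (X ^ 2 + Polynomial.C h * X - Polynomial.C f : k[X][X]).natDegree = 2 ∧ (X ^ 2 + Polynomial.C h * X - Polynomial.C f : k[X][X]).Monic := by
  refine ⟨by compute_degree!, by monicity!⟩

theorem finrank_specMap_adjoinRoot (P : k[X][X]) (hP : P.Monic) (y) :
    (Spec.map (CommRingCat.ofHom (algebraMap k[X] (AdjoinRoot P)))).finrank y = P.natDegree := by
  have := hP.finite_adjoinRoot
  have := hP.free_adjoinRoot
  refine (Scheme.Hom.finrank_SpecMap_algebraMap _ _ _).trans ?_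
  rw [Module.rankAtStalk_eq_finrank_of_free]
  exact (AdjoinRoot.powerBasis' hP).finrank

/-- A finite flat morphism of rank at least 1 everywhere is surjective. -/
theorem specMap_adjoinRoot (P : k[X][X]) (hP : P.Monic) (hdeg : 1 ≤ P.natDegree) :
    Surjective (Spec.map (CommRingCat.ofHom (algebraMap k[X] (AdjoinRoot P)))) := by
  have hfin' : Module.Finite k[X] (AdjoinRoot P) := hP.finite_adjoinRoot
  have hfree : Module.Free k[X] (AdjoinRoot P) := hP.free_adjoinRoot
  have hflat : Flat (Spec.map (CommRingCat.ofHom (algebraMap k[X] (AdjoinRoot P)))) := by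
    rw [Flat.SpecMap_iff]
    exact RingHom.flat_algebraMap_iff.2 (inferInstanceAs (Module.Flat k[X] (AdjoinRoot P)))
  have hfin : IsFinite (Spec.map (CommRingCat.ofHom (algebraMap k[X] (AdjoinRoot P)))) := by
    rw [IsFinite.SpecMap_iff]
    exact RingHom.finite_algebraMap.2 hfin'
  rw [← Scheme.Hom.one_le_finrank_iff_surjective]
  intro y
  rw [finrank_specMap_adjoinRoot P hP]
  exact hdeg

theorem finrank_eq_two [IsHyperelliptic π] : Flat π ∧ ∀ y, π.finrank y = 2 := by
  have := IsHyperelliptic.integral π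
  obtain ⟨g, f, h, ι, -, -, -, -, H⟩ := IsHyperelliptic.equation (π := π)
  obtain ⟨hdeg, hmonic⟩ := natDegree_hyperelliptic f h
  set P : k[X][X] := X ^ 2 + Polynomial.C h * X - Polynomial.C f
  have H' := isPullback_adjoinRoot π P ι H
  have hsurj := specMap_adjoinRoot P hmonic (by omega)
  have hrange : (P1.U k 1 : Set (P1 k)) ⊆ Set.range π := by
    intro y hy
    rw [← P1.opensRange_chart] at hy
    obtain ⟨t, rfl⟩ := hy
    obtain ⟨r, rfl⟩ := (Spec.map (P1.awayEquiv (k := k) 1).toCommRingCatIso.hom).surjective t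
    obtain ⟨z, rfl⟩ := hsurj.surj r
    refine ⟨ι z, ?_⟩
    rw [← Scheme.Hom.comp_apply, H'.w, Scheme.Hom.comp_apply, Scheme.Hom.comp_apply]
  -- The image of a finite morphism is closed, and this one contains the dense chart.
  have hπ : Function.Surjective π := by
    rw [← Set.range_eq_univ, ← Set.univ_subset_iff,
      ← ((P1.U k 1).2.dense ⟨P1.generic, P1.generic_mem_U 1⟩).closure_eq]
    exact closure_minimal hrange π.isClosedMap.isClosed_range
  have hfl := flat_of_surjective π hπ
  -- The generic point lies in both charts, which carries the rank across to infinity, where no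
  -- equation is given.
  have hconst (i : Fin 2) (y : P1 k) (hy : y ∈ P1.U k i) : π.finrank y = π.finrank P1.generic :=
    (finrank_eq_finrank_app π (P1.isAffineOpen_U i) y hy).trans
      (finrank_eq_finrank_app π (P1.isAffineOpen_U i) _ (P1.generic_mem_U i)).symm
  refine ⟨hfl, fun y => ?_⟩
  obtain ⟨i, hi⟩ := P1.exists_mem_U y
  obtain ⟨t⟩ : Nonempty (Spec (.of k[X])) := inferInstance
  have ht : (Spec.map (P1.awayEquiv (k := k) 1).toCommRingCatIso.hom ≫ P1.chart k) t ∈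
      P1.U k 1 := by
    rw [← P1.opensRange_chart, Scheme.Hom.comp_apply]
    exact ⟨_, rfl⟩
  have h₂ := Scheme.Hom.finrank_of_isPullback _ _ _ _ H' t
  rw [finrank_specMap_adjoinRoot P hmonic, hdeg, hconst 1 _ ht] at h₂
  rw [hconst i y hi, h₂]

theorem exists_finset_sum_eq_two [Finite k] [IsHyperelliptic π] (x : ClosedPt (P1 k)) :
    ∃ F : Finset (ClosedPt C), (∀ y, y ∈ F ↔ mapClosedPt π y = x) ∧
      (∀ y ∈ F, 0 < ramIdx π y.1 ∧ 0 < π.residueDegree y.1) ∧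
      ∑ y ∈ F, ramIdx π y.1 * π.residueDegree y.1 = 2 := by
  have := IsHyperelliptic.integral π
  have := IsHyperelliptic.smooth (π := π)
  obtain ⟨hflat, h2⟩ := finrank_eq_two π
  obtain ⟨i, hi⟩ := P1.exists_mem_U x.1
  have hst (y : C) : IsPrincipalIdealRing (C.presheaf.stalk y) :=
    isPrincipalIdealRing_stalk (π ≫ P1.toSpec k) y
  have h := exists_finset_sum_ramIdx_mul_residueDegree π (P1.isAffineOpen_U i) x hi
    (P1.not_isField i)
  rwa [← finrank_eq_finrank_app π (P1.isAffineOpen_U i) x.1 hi, h2] at h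

theorem isDoubleCover [Finite k] [IsHyperelliptic π] :
    IsDoubleCover (mapClosedPt π) (fun y => π.residueDegree y.1) (IsRamifiedPt π)
      (IsSplitPt π) (IsInertPt π) :=
  isDoubleCover_of_sum_eq_two π (exists_finset_sum_eq_two π)

end Hyperelliptic

end

noncomputable section

/-! ### Isomorphic spans and their linear functors -/

section PullbackIso

open Limits

variable {D : Type*} [Category* D] [HasPullbacks D] {A M N : D} (f : M ⟶ A) (g : N ⟶ A)
  (e : M ≅ N) (h : e.hom ≫ g = f)

/-- Pullbacks along isomorphic morphisms are isomorphic. -/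
def pullbackIsoOfIso {Z : D} (z : Z ⟶ A) : pullback z f ≅ pullback z g where
  hom := pullback.lift (pullback.fst z f) (pullback.snd z f ≫ e.hom)
    (by rw [pullback.condition, Category.assoc, h])
  inv := pullback.lift (pullback.fst z g) (pullback.snd z g ≫ e.inv)
    (by rw [pullback.condition, Category.assoc, ← h, e.inv_hom_id_assoc])
  hom_inv_id := by
    apply pullback.hom_ext <;>
      simp only [Category.assoc, pullback.lift_fst, pullback.lift_snd, pullback.lift_snd_assoc,
        Category.id_comp, e.hom_inv_id, Category.comp_id]
  inv_hom_id := by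
    apply pullback.hom_ext <;>
      simp only [Category.assoc, pullback.lift_fst, pullback.lift_snd, pullback.lift_snd_assoc,
        Category.id_comp, e.inv_hom_id, Category.comp_id]

theorem lift_comp_pullbackIsoOfIso {Z Z' : D} (z : Z ⟶ A) (z' : Z' ⟶ A) (φ : Z ⟶ Z')
    (hf : (pullback.fst z f ≫ φ) ≫ z' = pullback.snd z f ≫ f)
    (hg : (pullback.fst z g ≫ φ) ≫ z' = pullback.snd z g ≫ g) :
    pullback.lift (pullback.fst z f ≫ φ) (pullback.snd z f) hf ≫
        (pullbackIsoOfIso f g e h z').hom =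
      (pullbackIsoOfIso f g e h z).hom ≫
        pullback.lift (pullback.fst z g ≫ φ) (pullback.snd z g) hg := by
  apply pullback.hom_ext <;> simp only [pullbackIsoOfIso, Category.assoc, pullback.lift_fst,
    pullback.lift_fst_assoc, pullback.lift_snd, pullback.lift_snd_assoc]

/-- Pullback functors along isomorphic morphisms have isomorphic total spaces. -/
def pullbackForgetIso : Over.pullback f ⋙ Over.forget M ≅ Over.pullback g ⋙ Over.forget N :=
  NatIso.ofComponents (fun Z => pullbackIsoOfIso f g e h Z.hom)
    fun φ => lift_comp_pullbackIsoOfIso f g e h _ _ φ.left _ _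

end PullbackIso

/-! ### Cardinalities of spans and convolutions -/

namespace ObjSpan

variable {A : Type u}

/-- An isomorphism of spans induces an isomorphism of linear functors. -/
def linearFunctorIso (F G : ObjSpan A) (e : F.apex ≃ G.apex) (h : ∀ m, G.leg (e m) = F.leg m) :
    F.linearFunctor ≅ G.linearFunctor :=
  pullbackForgetIso _ _ e.toIso (by ext m; simp [h])

/-- Finiteness matters because `Nat.card` of an infinite type is 0. -/
theorem card_add (F G : ObjSpan A) (α : A) [Finite {m // F.leg m = α}]
    [Finite {m // G.leg m = α}] : (F + G).card α = F.card α + G.card α :=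
  (Nat.card_congr (Equiv.subtypeSum (p := fun m : F.apex ⊕ G.apex =>
    Sum.elim F.leg G.leg m = α))).trans
    (Nat.card_sum (α := {m // F.leg m = α}) (β := {m // G.leg m = α}))

theorem card_zeta (α : A) : (zeta A).card α = 1 :=
  Nat.card_eq_one_iff_unique.2 ⟨⟨fun a b => Subtype.ext (a.2.trans b.2.symm)⟩, ⟨⟨α, rfl⟩⟩⟩

open Classical in
theorem card_ofSet (s : Set A) (α : A) : (ofSet s).card α = if α ∈ s then 1 else 0 := by
  split_ifs with h
  · exact Nat.card_eq_one_iff_unique.2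
      ⟨⟨fun a b => Subtype.ext (Subtype.ext (a.2.trans b.2.symm))⟩, ⟨⟨⟨α, h⟩, rfl⟩⟩⟩
  · exact Nat.card_eq_zero.2 (.inl ⟨fun a => h (a.2 ▸ a.1.2)⟩)

/-- The span of `ζ * F` for a subset `F` consists of the `2`-simplices with `d₀` in this subset. -/
def convZetaEquiv [Add A] (s : Set A) :
    ConvApex (zeta A) (ofSet s) ≃ {σ : A × A // σ.2 ∈ s} where
  toFun p := ⟨p.simplex, by
    have h : p.simplex.2 = p.1.2.2.1 := congrArg Prod.snd p.2
    rw [h]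
    exact p.1.2.2.2⟩
  invFun σ := ⟨(σ.1, (σ.1.1, ⟨σ.1.2, σ.2⟩)), rfl⟩
  left_inv p := by
    have h := Prod.ext_iff.1 p.2
    exact Subtype.ext (Prod.ext rfl (Prod.ext h.1 (Subtype.ext h.2)))
  right_inv σ := rfl

section Antidiagonal

variable [AddMonoid A] [Finset.HasAntidiagonal A] (s : Set A) (α : A)

open Classical in
/-- The fibres of `ζ * F` for a subset `F`. -/
def fiberEquivAntidiagonal : {m // (zeta A * ofSet s).leg m = α} ≃
    {p // p ∈ (Finset.HasAntidiagonal.antidiagonal α).filter (Prod.snd · ∈ s)} where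
  toFun m := ⟨m.1.simplex, Finset.mem_filter.2
    ⟨Finset.HasAntidiagonal.mem_antidiagonal.2 m.2, ((convZetaEquiv s) m.1).2⟩⟩
  invFun p := ⟨(convZetaEquiv s).symm ⟨p.1, (Finset.mem_filter.1 p.2).2⟩,
    Finset.HasAntidiagonal.mem_antidiagonal.1 (Finset.mem_filter.1 p.2).1⟩
  left_inv m := Subtype.ext ((convZetaEquiv s).symm_apply_apply m.1)
  right_inv _ := rfl

theorem finite_fiber_zeta_mul : Finite {m // (zeta A * ofSet s).leg m = α} :=
  Finite.of_equiv _ (fiberEquivAntidiagonal s α).symm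

theorem card_zeta_mul : (zeta A * ofSet s).card α =
    ∑ p ∈ Finset.HasAntidiagonal.antidiagonal α, (zeta A).card p.1 * (ofSet s).card p.2 := by
  classical
  rw [card, Nat.card_congr (fiberEquivAntidiagonal s α), Nat.card_eq_fintype_card,
    Fintype.card_coe, Finset.card_filter]
  simp [card_zeta, card_ofSet]

end Antidiagonal

end ObjSpan

theorem IsDoubleCover.surjective {X Y : Type*} {m : X → Y} {f : X → ℕ} {R S I : Y → Prop}
    (H : IsDoubleCover m f R S I) : Function.Surjective m := by
  intro y
  rcases H.cases y with h | h | h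
  · obtain ⟨x, -, hx⟩ := H.ramified y h
    exact ⟨x, (hx x).2 rfl⟩
  · obtain ⟨x, x', -, -, -, hx⟩ := H.split y h
    exact ⟨x, (hx x).2 (.inl rfl)⟩
  · obtain ⟨x, -, hx⟩ := H.inert y h
    exact ⟨x, (hx x).2 rfl⟩

/-! ### The quadratic character and the bijection on convolutions -/

section QuadraticCharacter

variable {X Y : Scheme.{u}} (π : X ⟶ Y) [UniversallyClosed π]

/-- A ramified point in `α` makes both sides 0. Otherwise the product is `(-1)` to the inert sum,
which is the difference of the indicators of even and odd. -/
theorem prod_quadChar (H : IsDoubleCover (mapClosedPt π) (fun y => π.residueDegree y.1)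
    (IsRamifiedPt π) (IsSplitPt π) (IsInertPt π)) (α : EffCycle Y) :
    (α.prod fun x a => quadChar π x ^ a) = ((LPlus π).card α : ℚ) - (LMinus π).card α := by
  classical
  rw [LPlus, LMinus, ObjSpan.card_ofSet, ObjSpan.card_ofSet]
  by_cases hα : ∀ x, IsRamifiedPt π x → α x = 0
  · have h (x) (hx : x ∈ α.support) : quadChar π x ^ α x = if IsInertPt π x then (-1) ^ α x else 1 := by
      have hR : ¬ IsRamifiedPt π x := fun h => Finsupp.mem_support_iff.1 hx (hα x h)
      rcases H.cases x with h | h | h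
      · exact absurd h hR
      · rw [quadChar, if_neg hR, if_pos h, one_pow, if_neg (H.not_inert_of_split x h)]
      · rw [quadChar, if_neg hR, if_neg fun h' => H.not_inert_of_split x h' h, if_pos h, if_pos h]
    rw [Finsupp.prod, Finset.prod_congr rfl h, ← Finset.prod_filter, Finset.prod_pow_eq_pow_sum]
    change (-1) ^ inertSum π α = _
    rcases Nat.even_or_odd (inertSum π α) with he | ho
    · rw [if_pos ⟨hα, he⟩, if_neg fun h => Nat.not_even_iff_odd.2 h.2 he, he.neg_one_pow]
      simp
    · rw [if_neg fun h => Nat.not_even_iff_odd.2 ho h.2, if_pos ⟨hα, ho⟩, ho.neg_one_pow]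
      simp
  · rw [if_neg fun h => hα h.1, if_neg fun h => hα h.1]
    push Not at hα
    obtain ⟨x, hx, hx'⟩ := hα
    rw [Finsupp.prod, Finset.prod_eq_zero (Finsupp.mem_support_iff.2 hx')]
    · simp
    · rw [quadChar, if_pos hx, zero_pow hx']

/-- The bijection `T₁ ⊔ B⁻ ≃ B⁺`. -/
def convEquiv (H : IsDoubleCover (mapClosedPt π) (fun y => π.residueDegree y.1)
    (IsRamifiedPt π) (IsSplitPt π) (IsInertPt π)) {sec : ClosedPt Y → ClosedPt X}
    (hsec : ∀ x, IsSplitPt π x → mapClosedPt π (sec x) = x) :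
    EffCycle X ⊕ ObjSpan.ConvApex (ObjSpan.zeta (EffCycle Y)) (LMinus π) ≃
      ObjSpan.ConvApex (ObjSpan.zeta (EffCycle Y)) (LPlus π) :=
  (((Equiv.refl _).sumCongr (ObjSpan.convZetaEquiv (cyclesMinus π))).trans
    (H.equivPairs hsec)).trans (ObjSpan.convZetaEquiv (cyclesPlus π)).symm

end QuadraticCharacter

/-! ### Generating series of cycles on schemes over a finite field -/

section GeneratingSeries

variable {k : Type u} [Field k] {X : Scheme.{u}} (s : X ⟶ Spec (.of k))

theorem cycleDeg_eq_weight (α : EffCycle X) :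
    cycleDeg s α = Finsupp.weight (fun x : ClosedPt X => s.residueDegree x.1) α := by
  rw [Finsupp.weight_apply]
  rfl

theorem genSeries_eq_weightSeries (a : EffCycle X → ℕ) :
    genSeries s a =
      weightSeries (fun x : ClosedPt X => s.residueDegree x.1) fun α => (a α : ℚ) := by
  simp only [genSeries, weightSeries, cycleDeg_eq_weight]

theorem finite_cycleDeg_eq [Finite k] [LocallyOfFiniteType s] [QuasiCompact s] (n : ℕ) :
    {α | cycleDeg s α = n}.Finite := by
  simp only [cycleDeg_eq_weight]
  exact finite_weight_eq (residueDegree_pos s) (finite_residueDegree_le s) n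

theorem genSeries_add [Finite k] [LocallyOfFiniteType s] [QuasiCompact s]
    (a b : EffCycle X → ℕ) : genSeries s (fun α => a α + b α) = genSeries s a + genSeries s b := by
  rw [← sub_eq_iff_eq_add, genSeries_eq_weightSeries, genSeries_eq_weightSeries,
    genSeries_eq_weightSeries,
    ← weightSeries_sub (residueDegree_pos s) (finite_residueDegree_le s)]
  exact weightSeries_congr fun α => by simp

theorem genSeries_zeta [Finite k] [LocallyOfFiniteType s] [QuasiCompact s] :
    genSeries s (ObjSpan.zeta (EffCycle X)).card = zetaSeries s := by
  rw [genSeries_eq_weightSeries, ← genSeries_one_eq_zetaSeries]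
  exact weightSeries_congr fun α => by rw [ObjSpan.card_zeta, Nat.cast_one]

theorem genSeries_zeta_mul [Finite k] [LocallyOfFiniteType s] [QuasiCompact s]
    (S : Set (EffCycle X)) :
    genSeries s (ObjSpan.zeta (EffCycle X) * ObjSpan.ofSet S).card =
      zetaSeries s * genSeries s (ObjSpan.ofSet S).card := by
  classical
  rw [← genSeries_zeta, genSeries_eq_weightSeries, genSeries_eq_weightSeries,
    genSeries_eq_weightSeries, ← weightSeries_mul (residueDegree_pos s) (finite_residueDegree_le s)]
  exact weightSeries_congr fun α => by
    rw [ObjSpan.card_zeta_mul]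
    push_cast
    rfl

variable {Y : Scheme.{u}} (π : Y ⟶ X) [UniversallyClosed π]

theorem cycleDeg_pushCycle (β : EffCycle Y) : cycleDeg s (pushCycle π β) = cycleDeg (π ≫ s) β := by
  rw [cycleDeg_eq_weight, cycleDeg_eq_weight]
  refine (weight_pushMultiset (mapClosedPt π) (fun y => π.residueDegree y.1) _ β).trans ?_
  congr 2
  funext y
  exact (residueDegree_comp π s y.1).symm

variable [Finite k] [LocallyOfFiniteType s] [QuasiCompact s] [LocallyOfFiniteType π]
  [QuasiCompact π]

-- Pushforward preserves degrees, so a fibre consists of cycles of one fixed degree, of which there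
-- are finitely many.
include s in
theorem finite_fiber_pushZeta (α : EffCycle X) : Finite {m // (pushZeta π).leg m = α} := by
  refine Set.Finite.to_subtype ((finite_cycleDeg_eq (π ≫ s) (cycleDeg s α)).subset ?_)
  rintro β rfl
  exact (cycleDeg_pushCycle s π β).symm

theorem genSeries_pushZeta : genSeries s (pushZeta π).card = zetaSeries (π ≫ s) := by
  rw [genSeries_eq_weightSeries, ← genSeries_one_eq_zetaSeries]
  refine weightSeries_card_fiber (residueDegree_pos s) (finite_residueDegree_le s)
    (residueDegree_pos (π ≫ s)) (finite_residueDegree_le (π ≫ s)) (pushCycle π) fun β => ?_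
  rw [← cycleDeg_eq_weight, ← cycleDeg_eq_weight, cycleDeg_pushCycle]

variable (H : IsDoubleCover (mapClosedPt π) (fun y => π.residueDegree y.1)
    (IsRamifiedPt π) (IsSplitPt π) (IsInertPt π))

open scoped PowerSeries.WithPiTopology in
include H in
omit [LocallyOfFiniteType π] [QuasiCompact π] in
theorem hasProd_LFactor :
    HasProd (LFactor π s)
      (genSeries s (LPlus π).card - genSeries s (LMinus π).card) := by
  rw [genSeries_eq_weightSeries, genSeries_eq_weightSeries,
    ← weightSeries_sub (residueDegree_pos s) (finite_residueDegree_le s)]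
  simp only [← prod_quadChar π H]
  exact hasProd_eulerFactor (residueDegree_pos s) (finite_residueDegree_le s) (quadChar π)

open scoped PowerSeries.WithPiTopology in
include H in
omit [LocallyOfFiniteType π] [QuasiCompact π] in
theorem lConverges : LConverges π s :=
  (hasProd_LFactor s π H).multipliable

open scoped PowerSeries.WithPiTopology in
include H in
omit [LocallyOfFiniteType π] [QuasiCompact π] in
theorem genSeries_LPlus_sub_LMinus :
    genSeries s (LPlus π).card - genSeries s (LMinus π).card = LSeriesOf π s :=
  (hasProd_LFactor s π H).tprod_eq.symm

end GeneratingSeries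

/-! ### The main theorem -/

theorem theorem4p2 {k : Type u} [Field k] [Finite k] {C : Scheme.{u}} (π : C ⟶ P1 k)
    [IsHyperelliptic π] :
    -- the equivalence of linear functors `π_* ζ_C + ζ * L(C)⁻ ≅ ζ * L(C)⁺`
    Nonempty ((pushZeta π + ObjSpan.zeta (EffCycle (P1 k)) * LMinus π).linearFunctor ≅
      (ObjSpan.zeta (EffCycle (P1 k)) * LPlus π).linearFunctor) ∧
    -- the bijection `φ : T₁ ⊔ B⁻ ≃ B⁺` over `S₁`, explicit on `T₁` in terms of a section over
    -- the split points
    (∀ sec : ClosedPt (P1 k) → ClosedPt C,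
      (∀ x, IsSplitPt π x → mapClosedPt π (sec x) = x) →
      ∃ φ : EffCycle C ⊕ ObjSpan.ConvApex (ObjSpan.zeta (EffCycle (P1 k))) (LMinus π) ≃
          ObjSpan.ConvApex (ObjSpan.zeta (EffCycle (P1 k))) (LPlus π),
        (∀ β, (φ (Sum.inl β)).simplex.d₁ = pushCycle π β) ∧
        (∀ σ, (φ (Sum.inr σ)).simplex.d₁ = σ.simplex.d₁) ∧
        (∀ β, (φ (Sum.inl β)).simplex.d₂ =
          pushPart π (fun y => IsRamifiedPt π (mapClosedPt π y)) β +
          pushPart π (fun y => IsSplitPt π (mapClosedPt π y) ∧ y = sec (mapClosedPt π y)) β) ∧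
        (∀ β, (φ (Sum.inl β)).simplex.d₀ =
          pushPart π (fun y => IsSplitPt π (mapClosedPt π y) ∧ y ≠ sec (mapClosedPt π y)) β +
          pushPart π (fun y => IsInertPt π (mapClosedPt π y)) β)) ∧
    -- the cardinalities involved are finite, and add up
    (∀ α, Finite {m // (pushZeta π).leg m = α} ∧
      Finite {m // (ObjSpan.zeta (EffCycle (P1 k)) * LMinus π).leg m = α} ∧
      Finite {m // (ObjSpan.zeta (EffCycle (P1 k)) * LPlus π).leg m = α} ∧
      (pushZeta π).card α + (ObjSpan.zeta (EffCycle (P1 k)) * LMinus π).card α =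
        (ObjSpan.zeta (EffCycle (P1 k)) * LPlus π).card α) ∧
    (∀ n, {α | cycleDeg (P1.toSpec k) α = n}.Finite) ∧
    -- the generating functions of the cardinalities are the classical zeta and `L`-functions
    genSeries (P1.toSpec k) (pushZeta π).card = zetaSeries (π ≫ P1.toSpec k) ∧
    genSeries (P1.toSpec k) (ObjSpan.zeta (EffCycle (P1 k))).card = zetaSeries (P1.toSpec k) ∧
    LConverges π (P1.toSpec k) ∧
    genSeries (P1.toSpec k) (LPlus π).card - genSeries (P1.toSpec k) (LMinus π).card =
      LSeriesOf π (P1.toSpec k) ∧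
    zetaSeries (π ≫ P1.toSpec k) = zetaSeries (P1.toSpec k) * LSeriesOf π (P1.toSpec k) := by
  classical
  have H := isDoubleCover π
  -- The equivalence of functors needs some choice over the split points; surjectivity provides one.
  choose sec₀ hsec₀ using H.surjective
  replace hsec₀ : ∀ x, IsSplitPt π x → mapClosedPt π (sec₀ x) = x := fun x _ => hsec₀ x
  have hφ (sec : ClosedPt (P1 k) → ClosedPt C) (hsec : ∀ x, IsSplitPt π x → mapClosedPt π (sec x) = x) :
      (∀ β, (convEquiv π H hsec (Sum.inl β)).simplex.d₁ = pushCycle π β) ∧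
      (∀ σ, (convEquiv π H hsec (Sum.inr σ)).simplex.d₁ = σ.simplex.d₁) :=
    ⟨fun β => H.splitPush_add β, fun σ => H.equivPairs_inr hsec _⟩
  let e : (pushZeta π + ObjSpan.zeta (EffCycle (P1 k)) * LMinus π).apex ≃
      (ObjSpan.zeta (EffCycle (P1 k)) * LPlus π).apex := convEquiv π H hsec₀
  have he (m) : (ObjSpan.zeta (EffCycle (P1 k)) * LPlus π).leg (e m) =
      (pushZeta π + ObjSpan.zeta (EffCycle (P1 k)) * LMinus π).leg m := by
    obtain β | σ := m
    exacts [(hφ sec₀ hsec₀).1 β, (hφ sec₀ hsec₀).2 σ]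
  have hfin := finite_fiber_pushZeta (P1.toSpec k) π
  have hcard (α) : (pushZeta π).card α + (ObjSpan.zeta (EffCycle (P1 k)) * LMinus π).card α =
      (ObjSpan.zeta (EffCycle (P1 k)) * LPlus π).card α := by
    have := hfin α
    have : Finite {m // (ObjSpan.zeta (EffCycle (P1 k)) * LMinus π).leg m = α} :=
      ObjSpan.finite_fiber_zeta_mul (cyclesMinus π) α
    rw [← ObjSpan.card_add]
    exact Nat.card_congr (e.subtypeEquiv fun m => by rw [he])
  have hL : genSeries (P1.toSpec k) (LPlus π).card - genSeries (P1.toSpec k) (LMinus π).card =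
      LSeriesOf π (P1.toSpec k) := genSeries_LPlus_sub_LMinus _ π H
  refine ⟨⟨ObjSpan.linearFunctorIso _ _ e he⟩,
    fun sec hsec => ⟨convEquiv π H hsec, (hφ sec hsec).1, (hφ sec hsec).2, fun β => rfl,
      fun β => rfl⟩,
    fun α => ⟨hfin α, ObjSpan.finite_fiber_zeta_mul _ α, ObjSpan.finite_fiber_zeta_mul _ α,
      hcard α⟩, finite_cycleDeg_eq _, genSeries_pushZeta _ π, genSeries_zeta _,
    lConverges _ π H, hL, ?_⟩
  -- Summing the cardinality identity gives `Z(C) + Z(ℙ¹) L⁻ = Z(ℙ¹) L⁺` once convolutions become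
  -- products.
  have hadd : genSeries (P1.toSpec k) (pushZeta π).card +
      genSeries (P1.toSpec k) (ObjSpan.zeta (EffCycle (P1 k)) * LMinus π).card =
        genSeries (P1.toSpec k) (ObjSpan.zeta (EffCycle (P1 k)) * LPlus π).card := by
    rw [← genSeries_add]
    exact congrArg _ (funext hcard)
  rw [← hL, mul_sub, LPlus, LMinus, ← genSeries_zeta_mul, ← genSeries_zeta_mul,
    ← genSeries_pushZeta]
  exact eq_sub_of_add_eq hadd

end
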